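/- Consider the complex superspace $\mathbb{C}^{3|3}$ with even coordinates $y_1,y_2,y_3$ and odd coordinates $\xi_1,\xi_2,\xi_3$, the vector fields $$e_i=\partial_{y_i}\ (i=1,2,3),\quad f_1=\partial_{\xi_1}+\xi_2\partial_{y_3}+y_1\partial_{\xi_3},\quad f_2=\partial_{\xi_2}+\xi_1\partial_{y_3}+y_2\partial_{\xi_3},\quad f_3=\partial_{\xi_3},$$ and the distribution $\mathcal{D}=\mathcal{D}^{2|2}=\langle e_1,e_2\,|\,f_1,f_2\rangle$. The only nontrivial supercommutators of these fields are $[e_1,f_1]=[e_2,f_2]=f_3$ and $[f_1,f_2]=2e_3$. (This is the local coordinate model of the distribution on the flag supermanifold $M^{3|3}=G/P_{23}^{\rm I}$ of $D(2,1;a)$.) Let $U\subset\mathbb{C}^3$ be open and such that every fibre $\{y\in U: y_3=t\}$ is connected or empty, and let $W\subset\mathbb{C}$ be the set of values of $y_3$ on $U$. Let $\mathfrak{sym}=\mathfrak{sym}(U,\mathcal{D})$ be the space of vector fields $X$ over $U$, with coefficients holomorphic in $y$ and polynomial in $\xi$, such that $[X,\mathcal{D}]\subset\mathcal{D}$. Then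 the following hold. 1. $\mathfrak{sym}$ is a Lie superalgebra (closed under the supercommutator, and containing the even and odd parts of each of its elements), and it is infinite-dimensional if $U\ne\emptyset$. 2. $\mathfrak{sym}$ is parametrized by two arbitrary functions $h,g$ of $(y_3,\xi_1,\xi_2,\xi_3)$, holomorphic in $y_3\in W$. For each parity, the assignment $$X=\tfrac12(-1)^{|h|}\bigl(f_2(h)\,f_1+f_1(h)\,f_2\bigr)+h\,e_3+\tilde g\,f_3+m_1e_1+m_2e_2,$$ $$\tilde g=g-\tfrac12(-1)^{|h|}\bigl(f_2(h)\,y_1+f_1(h)\,y_2-y_1y_2\,\partial_{\xi_3}h\bigr),\qquad m_i=-(-1)^{|g|}f_i(\tilde g),$$ is a bijection from the pairs $(h,g)$ with $h$ of that parity and $g$ of the opposite parity onto the symmetries $X$ of parity $|X|=|h|$. 3. Assign the weights $w(y_1)=w(y_2)=w(\xi_1)=w(\xi_2)=1$ and $w(y_3)=w(\xi_3)=2$, and let $\mathfrak{sym}_k$ be the space of symmetries of weight $k\in\mathbb{Z}$. Then $[\mathfrak{sym}_k,\mathfrak{sym}_l]\subset\mathfrak{sym}_{k+l}$ and the sum of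 the spaces $\mathfrak{sym}_k$ is direct. If moreover $U$ is connected and contains $0$, then this sum is exactly the algebra of polynomial symmetries, and $\dim\mathfrak{sym}_k=(1|1),(2|2),(3|3),(4|4),(4|4),\dots$ for $k=-2,-1,0,1,2,\dots$ (that is, $(4|4)$ for all $k\ge1$), while $\mathfrak{sym}_k=0$ for $k<-2$. -/

import Mathlib

open TopologicalSpace

noncomputable section

namespace SuperSym

/-! ### Holomorphic functions on an open set -/

open Classical in
/-- Extension by zero of a function on an open set. -/
def zeroExt {E : Type} [TopologicalSpace E] (U : Opens E) (f : U → ℂ) : E → ℂ :=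
  fun x => if hx : x ∈ U then f ⟨x, hx⟩ else 0

lemma zeroExt_of_mem {E : Type} [TopologicalSpace E] (U : Opens E) (f : U → ℂ) {x : E}
    (hx : x ∈ U) : zeroExt U f x = f ⟨x, hx⟩ := by
  simp [zeroExt, hx]

lemma zeroExt_add {E : Type} [TopologicalSpace E] (U : Opens E) (f g : U → ℂ) :
    zeroExt U (f + g) = zeroExt U f + zeroExt U g := by
  funext x
  by_cases hx : x ∈ U <;> simp [zeroExt, hx]

lemma zeroExt_mul {E : Type} [TopologicalSpace E] (U : Opens E) (f g : U → ℂ) :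
    zeroExt U (f * g) = zeroExt U f * zeroExt U g := by
  funext x
  by_cases hx : x ∈ U <;> simp [zeroExt, hx]

lemma zeroExt_smul {E : Type} [TopologicalSpace E] (U : Opens E) (c : ℂ) (f : U → ℂ) :
    zeroExt U (c • f) = c • zeroExt U f := by
  funext x
  by_cases hx : x ∈ U <;> simp [zeroExt, hx]

lemma zeroExt_restrict_eventuallyEq {E : Type} [TopologicalSpace E] (U : Opens E) (F : E → ℂ)
    {x : E} (hx : x ∈ U) : zeroExt U (fun z : U => F z) =ᶠ[nhds x] F := by
  filter_upwards [U.2.mem_nhds hx] with z hz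
  exact zeroExt_of_mem U _ hz

/-- The algebra `𝒪(U)` of holomorphic (complex analytic) functions on the open set `U`. -/
def holo {E : Type} [NormedAddCommGroup E] [NormedSpace ℂ E] (U : Opens E) :
    Subalgebra ℂ (U → ℂ) where
  carrier := {f | AnalyticOnNhd ℂ (zeroExt U f) U}
  mul_mem' := by
    intro f g hf hg
    simp only [Set.mem_ofPred_eq, zeroExt_mul] at *
    exact hf.mul hg
  add_mem' := by
    intro f g hf hg
    simp only [Set.mem_ofPred_eq, zeroExt_add] at *
    exact hf.add hg
  algebraMap_mem' := by
    intro c x hx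
    exact (analyticAt_const (v := c)).congr
      (zeroExt_restrict_eventuallyEq U (fun _ => c) hx).symm

/-- The partial derivative `∂/∂yᵢ` on `𝒪(U)`, `U ⊆ ℂ³`. -/
def pderiv (U : Opens (Fin 3 → ℂ)) (i : Fin 3) : holo U →ₗ[ℂ] holo U where
  toFun f := ⟨fun x => fderiv ℂ (zeroExt U f.1) x (Pi.single i 1), by
    intro x hx
    have h1 : AnalyticAt ℂ (fun z => fderiv ℂ (zeroExt U f.1) z (Pi.single i 1)) x :=
      ((ContinuousLinearMap.apply ℂ ℂ (Pi.single i (1 : ℂ) : Fin 3 → ℂ)).analyticAt _).fun_comp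
        (AnalyticAt.fderiv (f.2 x hx))
    exact h1.congr (zeroExt_restrict_eventuallyEq U _ hx).symm⟩
  map_add' f g := by
    ext x
    have hf := (f.2 x.1 x.2).differentiableAt
    have hg := (g.2 x.1 x.2).differentiableAt
    simp [zeroExt_add, fderiv_add hf hg]
  map_smul' c f := by
    ext x
    have hf := (f.2 x.1 x.2).differentiableAt
    simp [zeroExt_smul, fderiv_const_smul hf]

/-- The coordinate function `yᵢ` on `U ⊆ ℂ³`. -/
def coordFun (U : Opens (Fin 3 → ℂ)) (i : Fin 3) : holo U :=
  ⟨fun x => x.1 i, by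
    intro x hx
    have h1 : AnalyticAt ℂ (fun z : Fin 3 → ℂ => z i) x :=
      (ContinuousLinearMap.proj (R := ℂ) (φ := fun _ : Fin 3 => ℂ) i).analyticAt x
    exact h1.congr (zeroExt_restrict_eventuallyEq U _ hx).symm⟩

/-- The open set of all values taken by the coordinate `y₃` on `U`. -/
def proj3 (U : Opens (Fin 3 → ℂ)) : Opens ℂ :=
  ⟨(fun y : Fin 3 → ℂ => y 2) '' U, isOpenMap_eval (2 : Fin 3) _ U.2⟩

/-- A holomorphic function of `y₃` regarded as a function on `U`. -/
def pull (U : Opens (Fin 3 → ℂ)) (f : holo (proj3 U)) : holo U :=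
  ⟨fun x => f.1 ⟨x.1 2, x.1, x.2, rfl⟩, by
    intro x hx
    have hx2 : x 2 ∈ proj3 U := ⟨x, hx, rfl⟩
    have h0 : AnalyticAt ℂ (fun z : Fin 3 → ℂ => z 2) x :=
      (ContinuousLinearMap.proj (R := ℂ) (φ := fun _ : Fin 3 => ℂ) 2).analyticAt x
    have h1 : AnalyticAt ℂ (fun z : Fin 3 → ℂ => zeroExt (proj3 U) f.1 (z 2)) x :=
      AnalyticAt.fun_comp (f.2 (x 2) hx2) h0
    refine h1.congr ?_
    filter_upwards [U.2.mem_nhds hx] with z hz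
    have hz2 : z 2 ∈ proj3 U := ⟨z, hz, rfl⟩
    rw [zeroExt_of_mem U _ hz, zeroExt_of_mem (proj3 U) _ hz2]⟩

/-! ### Superfunctions in three odd variables -/

/-- Superfunctions `∑_S F_S ξ_S` in the odd variables `ξ₁, ξ₂, ξ₃` with coefficients in `A`, where
`ξ_S` is the product of the `ξᵢ`, `i ∈ S`, in increasing order. The value at `S` is `F_S`.
(Products of superfunctions are given by `gmul`, not by the pointwise product.) -/
abbrev SF (A : Type) : Type := Finset (Fin 3) → A

/-- The sign in `ξ_S ξ_T = ± ξ_{S ∪ T}` for disjoint `S`, `T`. -/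
def gsign (S T : Finset (Fin 3)) : ℤ :=
  (-1) ^ ((S ×ˢ T).filter (fun p => p.2 < p.1)).card

/-- The product of superfunctions (Grassmann product). -/
def gmul {A : Type} [CommRing A] (F G : SF A) : SF A :=
  fun S => ∑ T ∈ S.powerset, gsign T (S \ T) • (F T * G (S \ T))

infixl:70 " ⋄ " => SuperSym.gmul

lemma gmul_add {A : Type} [CommRing A] (F G H : SF A) : F ⋄ (G + H) = F ⋄ G + F ⋄ H := by
  funext S
  simp [gmul, mul_add, Finset.sum_add_distrib]

lemma add_gmul {A : Type} [CommRing A] (F G H : SF A) : (F + G) ⋄ H = F ⋄ H + G ⋄ H := by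
  funext S
  simp [gmul, add_mul, Finset.sum_add_distrib]

lemma gmul_smul {A : Type} [CommRing A] [Algebra ℂ A] (c : ℂ) (F G : SF A) :
    F ⋄ (c • G) = c • (F ⋄ G) := by
  funext S
  simp [gmul, Finset.smul_sum]

lemma smul_gmul {A : Type} [CommRing A] [Algebra ℂ A] (c : ℂ) (F G : SF A) :
    (c • F) ⋄ G = c • (F ⋄ G) := by
  funext S
  simp [gmul, Finset.smul_sum]

/-- A function of the even variables as a superfunction. -/
def ofFun {A : Type} [CommRing A] (a : A) : SF A := Pi.single ∅ a

/-- The odd coordinate `ξᵢ`. -/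
def xi (A : Type) [CommRing A] (i : Fin 3) : SF A := Pi.single {i} 1

/-- The (left) derivative `∂/∂ξᵢ`. -/
def dxi {A : Type} [CommRing A] [Algebra ℂ A] (i : Fin 3) : SF A →ₗ[ℂ] SF A where
  toFun F := fun S => if i ∈ S then 0 else gsign {i} S • F (insert i S)
  map_add' F G := by
    funext S
    by_cases h : i ∈ S <;> simp [h]
  map_smul' c F := by
    funext S
    by_cases h : i ∈ S <;> simp [h]

/-- The component of parity `p` of a superfunction. -/
def sfComp {A : Type} [CommRing A] [Algebra ℂ A] (p : ZMod 2) : SF A →ₗ[ℂ] SF A where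
  toFun F := fun S => if (S.card : ZMod 2) = p then F S else 0
  map_add' F G := by
    funext S
    by_cases h : (S.card : ZMod 2) = p <;> simp [h]
  map_smul' c F := by
    funext S
    by_cases h : (S.card : ZMod 2) = p <;> simp [h]

/-- Superfunctions of parity `p`. -/
def sfParity (A : Type) [CommRing A] [Algebra ℂ A] (p : ZMod 2) : Submodule ℂ (SF A) where
  carrier := {F | ∀ S, (S.card : ZMod 2) ≠ p → F S = 0}
  add_mem' := by
    intro F G hF hG S hS
    simp [hF S hS, hG S hS]
  zero_mem' := by
    intro S _
    rfl
  smul_mem' := by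
    intro c F hF S hS
    simp [hF S hS]

/-! ### Vector fields on the superdomain with coordinates `(y₁, y₂, y₃ | ξ₁, ξ₂, ξ₃)` -/

/-- Labels of the coordinates: `inl i` stands for `yᵢ`, `inr i` for `ξᵢ` (numbered from `0`). -/
abbrev Idx : Type := Fin 3 ⊕ Fin 3

/-- Parity of a coordinate. -/
def idxParity : Idx → ZMod 2
  | Sum.inl _ => 0
  | Sum.inr _ => 1

/-- Weight of a coordinate: `1, 1, 2` for `y₁, y₂, y₃` and `1, 1, 2` for `ξ₁, ξ₂, ξ₃`. -/
def idxWeight : Idx → ℤ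
  | Sum.inl i => ![1, 1, 2] i
  | Sum.inr i => ![1, 1, 2] i

/-- Superfunctions on the superdomain over `U ⊆ ℂ³`. -/
abbrev SFun (U : Opens (Fin 3 → ℂ)) : Type := SF (holo U)

/-- The coordinates as superfunctions. -/
def coord (U : Opens (Fin 3 → ℂ)) : Idx → SFun U
  | Sum.inl i => ofFun (coordFun U i)
  | Sum.inr i => xi (holo U) i

/-- The coordinate derivations `∂/∂yᵢ` and `∂/∂ξᵢ` of superfunctions. -/
def pd (U : Opens (Fin 3 → ℂ)) : Idx → (SFun U →ₗ[ℂ] SFun U)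
  | Sum.inl i => LinearMap.pi (fun S => (pderiv U i).comp (LinearMap.proj S))
  | Sum.inr i => dxi i

/-- Vector fields `X = ∑_A X_A ∂_A` over `U`, given by their coefficients. -/
abbrev VF (U : Opens (Fin 3 → ℂ)) : Type := Idx → SFun U

/-- The coordinate vector field `∂_A`. -/
def bas (U : Opens (Fin 3 → ℂ)) (A : Idx) : VF U := Pi.single A (ofFun 1)

/-- Left multiplication of a vector field by a superfunction. -/
def fmul {U : Opens (Fin 3 → ℂ)} (F : SFun U) (X : VF U) : VF U := fun A => F ⋄ X A

infixr:73 " ⊡ " => SuperSym.fmul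

/-- The action `X(F) = ∑_A X_A ∂_A F` of a vector field on a superfunction. -/
def act {U : Opens (Fin 3 → ℂ)} (X : VF U) (F : SFun U) : SFun U :=
  ∑ A, X A ⋄ pd U A F

/-- The component of parity `p` of a vector field. -/
def vfComp {U : Opens (Fin 3 → ℂ)} (p : ZMod 2) (X : VF U) : VF U :=
  fun A => sfComp (p + idxParity A) (X A)

/-- The supercommutator. For `X`, `Y` of parities `p`, `q` it is `X ∘ Y - (-1)^{pq} Y ∘ X`, with
coefficients `[X, Y]_A = X(Y_A) - (-1)^{pq} Y(X_A)`; it is extended biadditively. -/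
def bracket {U : Opens (Fin 3 → ℂ)} (X Y : VF U) : VF U :=
  fun A => ∑ p : ZMod 2, ∑ q : ZMod 2,
    (act (vfComp p X) (vfComp q Y A)
      - (-1 : ℂ) ^ (p.val * q.val) • act (vfComp q Y) (vfComp p X A))

lemma act_add_left {U : Opens (Fin 3 → ℂ)} (X Y : VF U) (F : SFun U) :
    act (X + Y) F = act X F + act Y F := by
  simp only [act, Pi.add_apply, add_gmul, Finset.sum_add_distrib]

lemma act_smul_left {U : Opens (Fin 3 → ℂ)} (c : ℂ) (X : VF U) (F : SFun U) :
    act (c • X) F = c • act X F := by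
  simp only [act, Pi.smul_apply, smul_gmul, Finset.smul_sum]

lemma act_add_right {U : Opens (Fin 3 → ℂ)} (X : VF U) (F G : SFun U) :
    act X (F + G) = act X F + act X G := by
  simp only [act, map_add, gmul_add, Finset.sum_add_distrib]

lemma act_smul_right {U : Opens (Fin 3 → ℂ)} (c : ℂ) (X : VF U) (F : SFun U) :
    act X (c • F) = c • act X F := by
  simp only [act, map_smul, gmul_smul, Finset.smul_sum]

lemma vfComp_add {U : Opens (Fin 3 → ℂ)} (p : ZMod 2) (X Y : VF U) :
    vfComp p (X + Y) = vfComp p X + vfComp p Y := by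
  funext A
  simp [vfComp]

lemma vfComp_smul {U : Opens (Fin 3 → ℂ)} (p : ZMod 2) (c : ℂ) (X : VF U) :
    vfComp p (c • X) = c • vfComp p X := by
  funext A
  simp [vfComp]

lemma bracket_add_left {U : Opens (Fin 3 → ℂ)} (X Y Z : VF U) :
    bracket (X + Y) Z = bracket X Z + bracket Y Z := by
  funext A
  simp only [bracket, vfComp_add, act_add_left, act_add_right, Pi.add_apply, smul_add,
    ← Finset.sum_add_distrib]
  refine Finset.sum_congr rfl fun p _ => Finset.sum_congr rfl fun q _ => ?_
  abel

lemma bracket_smul_left {U : Opens (Fin 3 → ℂ)} (c : ℂ) (X Z : VF U) :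
    bracket (c • X) Z = c • bracket X Z := by
  funext A
  simp only [bracket, vfComp_smul, act_smul_left, act_smul_right, Pi.smul_apply,
    Finset.smul_sum, smul_sub]
  refine Finset.sum_congr rfl fun p _ => Finset.sum_congr rfl fun q _ => ?_
  rw [smul_comm c]

/-- Vector fields of parity `p`. -/
def vfParity (U : Opens (Fin 3 → ℂ)) (p : ZMod 2) : Submodule ℂ (VF U) where
  carrier := {X | ∀ A, X A ∈ sfParity (holo U) (p + idxParity A)}
  add_mem' := fun hX hY A => Submodule.add_mem _ (hX A) (hY A)
  zero_mem' := fun _ => Submodule.zero_mem _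
  smul_mem' := fun c _ hX A => Submodule.smul_mem _ c (hX A)

/-! ### The distribution and its symmetries -/

/-- The fields `e₁ = ∂_{y₁}`, `e₂ = ∂_{y₂}`, `e₃ = ∂_{y₃}` (numbered from `0`). -/
def e (U : Opens (Fin 3 → ℂ)) (i : Fin 3) : VF U := bas U (Sum.inl i)

/-- `f₁ = ∂_{ξ₁} + ξ₂ ∂_{y₃} + y₁ ∂_{ξ₃}`. -/
def f1 (U : Opens (Fin 3 → ℂ)) : VF U :=
  bas U (Sum.inr 0) + coord U (Sum.inr 1) ⊡ bas U (Sum.inl 2)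
    + coord U (Sum.inl 0) ⊡ bas U (Sum.inr 2)

/-- `f₂ = ∂_{ξ₂} + ξ₁ ∂_{y₃} + y₂ ∂_{ξ₃}`. -/
def f2 (U : Opens (Fin 3 → ℂ)) : VF U :=
  bas U (Sum.inr 1) + coord U (Sum.inr 0) ⊡ bas U (Sum.inl 2)
    + coord U (Sum.inl 1) ⊡ bas U (Sum.inr 2)

/-- The fields `f₁`, `f₂`, `f₃ = ∂_{ξ₃}` (numbered from `0`). -/
def f (U : Opens (Fin 3 → ℂ)) : Fin 3 → VF U := ![f1 U, f2 U, bas U (Sum.inr 2)]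

/-- The distribution `𝒟 = ⟨e₁, e₂ | f₁, f₂⟩`: all combinations of these fields with superfunctions
as coefficients. -/
def dist (U : Opens (Fin 3 → ℂ)) : Submodule ℂ (VF U) :=
  Submodule.span ℂ
    {Y | ∃ F : SFun U, ∃ Z ∈ ({e U 0, e U 1, f U 0, f U 1} : Set (VF U)), Y = F ⊡ Z}

/-- The symmetries of the distribution over `U`: vector fields `X` with `[X, 𝒟] ⊆ 𝒟`. -/
def sym (U : Opens (Fin 3 → ℂ)) : Submodule ℂ (VF U) where
  carrier := {X | ∀ Y ∈ dist U, bracket X Y ∈ dist U}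
  add_mem' := by
    intro X X' hX hX' Y hY
    rw [bracket_add_left]
    exact Submodule.add_mem _ (hX Y hY) (hX' Y hY)
  zero_mem' := by
    intro Y _
    have h : bracket (0 : VF U) Y = 0 := by
      simpa using bracket_smul_left (0 : ℂ) (0 : VF U) Y
    rw [h]
    exact Submodule.zero_mem _
  smul_mem' := by
    intro c X hX Y hY
    rw [bracket_smul_left]
    exact Submodule.smul_mem _ c (hX Y hY)

/-! ### The grading -/

/-- The weighted Euler field `∑_A w(A) z_A ∂_A`. -/
def euler (U : Opens (Fin 3 → ℂ)) : VF U := fun A => (idxWeight A : ℂ) • coord U A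

/-- Superfunctions of weight `d`. -/
def sfWeight (U : Opens (Fin 3 → ℂ)) (d : ℤ) : Submodule ℂ (SFun U) where
  carrier := {F | act (euler U) F = (d : ℂ) • F}
  add_mem' := by
    intro F G hF hG
    simp only [Set.mem_ofPred_eq] at *
    rw [act_add_right, hF, hG, smul_add]
  zero_mem' := by
    have h : act (euler U) (0 : SFun U) = 0 := by
      simpa using act_smul_right (0 : ℂ) (euler U) 0
    simp [h]
  smul_mem' := by
    intro c F hF
    simp only [Set.mem_ofPred_eq] at *
    rw [act_smul_right, hF, smul_comm]

/-- Vector fields of weight `k`: the coefficient at `∂_A` has weight `k + w(A)`. -/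
def vfWeight (U : Opens (Fin 3 → ℂ)) (k : ℤ) : Submodule ℂ (VF U) where
  carrier := {X | ∀ A, X A ∈ sfWeight U (k + idxWeight A)}
  add_mem' := fun hX hY A => Submodule.add_mem _ (hX A) (hY A)
  zero_mem' := fun _ => Submodule.zero_mem _
  smul_mem' := fun c _ hX A => Submodule.smul_mem _ c (hX A)

/-- The graded component of weight `k` of the symmetry algebra. -/
def symWeight (U : Opens (Fin 3 → ℂ)) (k : ℤ) : Submodule ℂ (VF U) := sym U ⊓ vfWeight U k

/-- Polynomial vector fields: all coefficients are polynomials in `y₁, y₂, y₃` and `ξ₁, ξ₂, ξ₃`. -/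
def vfPoly (U : Opens (Fin 3 → ℂ)) : Submodule ℂ (VF U) where
  carrier := {X | ∀ A S, ∃ P : MvPolynomial (Fin 3) ℂ,
    ∀ x : U, (X A S).1 x = MvPolynomial.eval x.1 P}
  add_mem' := by
    intro X Y hX hY A S
    obtain ⟨P, hP⟩ := hX A S
    obtain ⟨Q, hQ⟩ := hY A S
    exact ⟨P + Q, fun x => by simp [← hP x, ← hQ x]⟩
  zero_mem' := fun A S => ⟨0, fun x => by simp⟩
  smul_mem' := by
    intro c X hX A S
    obtain ⟨P, hP⟩ := hX A S
    exact ⟨c • P, fun x => by simp [← hP x, MvPolynomial.smul_eval]⟩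

/-- The numbers `0` for `k < -2` and `1, 2, 3, 4, 4, 4, …` for `k = -2, -1, 0, 1, 2, 3, …`. -/
def tableDim (k : ℤ) : ℕ :=
  if k < -2 then 0 else if k = -2 then 1 else if k = -1 then 2 else if k = 0 then 3 else 4

/-! ### The general symmetry -/

/-- Superfunctions `h(y₃, ξ₁, ξ₂, ξ₃)`, holomorphic in `y₃` on the set of values of `y₃` on `U`. -/
abbrev SFun3 (U : Opens (Fin 3 → ℂ)) : Type := SF (holo (proj3 U))

/-- A superfunction of `(y₃, ξ₁, ξ₂, ξ₃)` regarded as a superfunction over `U`. -/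
def lift (U : Opens (Fin 3 → ℂ)) (h : SFun3 U) : SFun U := fun S => pull U (h S)

/-- `g̃ = g - ½ (-1)^{|h|} (f₂(h) y₁ + f₁(h) y₂ - y₁ y₂ ∂_{ξ₃} h)`, for `h` of parity `p`. -/
def gTilde (U : Opens (Fin 3 → ℂ)) (p : ZMod 2) (h g : SFun3 U) : SFun U :=
  lift U g - ((1 / 2 : ℂ) * (-1) ^ p.val) •
    (act (f U 1) (lift U h) ⋄ coord U (Sum.inl 0) + act (f U 0) (lift U h) ⋄ coord U (Sum.inl 1)
      - coord U (Sum.inl 0) ⋄ coord U (Sum.inl 1) ⋄ pd U (Sum.inr 2) (lift U h))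

/-- For `h` of parity `p` and `g` of parity `p + 1`, the vector field
`½ (-1)^{|h|} (f₂(h) f₁ + f₁(h) f₂) + h e₃ + g̃ f₃ + m₁ e₁ + m₂ e₂` with
`mᵢ = -(-1)^{|g|} fᵢ(g̃)`. -/
def symField (U : Opens (Fin 3 → ℂ)) (p : ZMod 2) (h g : SFun3 U) : VF U :=
  ((1 / 2 : ℂ) * (-1) ^ p.val) •
      (act (f U 1) (lift U h) ⊡ f U 0 + act (f U 0) (lift U h) ⊡ f U 1)
    + lift U h ⊡ e U 2 + gTilde U p h g ⊡ f U 2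
    + (-(-1 : ℂ) ^ (p + 1).val • act (f U 0) (gTilde U p h g)) ⊡ e U 0
    + (-(-1 : ℂ) ^ (p + 1).val • act (f U 1) (gTilde U p h g)) ⊡ e U 1

end SuperSym

end

noncomputable section

namespace SuperSym

/-! ### The Grassmann algebra in three odd variables -/

/-! The fields `e`, `f` form a frame, and the distribution is the common kernel of the two
coefficients `hCoeff` (at e₃) and `gCoeff` (at f₃), see `mem_dist_iff`. By the Leibniz rule a
homogeneous field X is a symmetry as soon as its brackets with e₁, e₂, f₁, f₂ have no e₃ and no f₃
coefficient. This gives eight equations (`mem_sym_iff`). With h and g̃ the two coefficients of X,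
they say: h does not depend on y₁, y₂; the f₁ and f₂ coefficients of X are ±½f₂(h) and ±½f₁(h); the
e₁ and e₂ coefficients are ±f₁(g̃) and ±f₂(g̃); and ∂g̃/∂y₁, ∂g̃/∂y₂ are prescribed by h. So X is
determined by h and g̃. The equations for g̃ have the explicit solution -`gShift` (`pd_gShift`), so
that g̃ = g - `gShift` with g again free of y₁, y₂. Connected fibres turn "free of y₁, y₂" into
"function of y₃ and ξ" (`exists_pull_eq`). Nothing further couples h and g, whence the bijection
`bijOn_symField`.

Closure under the bracket is the super Jacobi identity (`bracket_jacobi`), which follows from the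
fact that the bracket acts on functions as the supercommutator of operators (`act_bracket`).

Weights are eigenvalues of the Euler field, so the sum of the graded pieces is direct. The shift
from g to g̃ preserves weight, hence X has weight k exactly when h and g have weight k + 2. For
fixed parity of X, the pair (h, g) is the same as one superfunction u = h + g of mixed parity
(`symLin`), so both parities of X give the same dimension: the number of monomials y₃ⁿ ξ_S with 2n +
w(S) = k + 2. The weights w(S) are 0, 1, 1, 2, 2, 3, 3, 4, four of each parity, which produces 1, 2,
3, 4, 4, …. That a holomorphic solution of the weight equation is a monomial comes from the equation
t φ' = c φ near 0 and the identity theorem (`exists_monomial_of_ode`). -/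

theorem forall_finset_fin_three {P : Finset (Fin 3) → Prop} :
    (∀ S, P S) ↔ P ∅ ∧ P {0} ∧ P {1} ∧ P {2} ∧ P {0, 1} ∧ P {0, 2} ∧ P {1, 2} ∧ P {0, 1, 2} := by
  constructor
  · intro h; exact ⟨h _, h _, h _, h _, h _, h _, h _, h _⟩
  · rintro ⟨h0, h1, h2, h3, h4, h5, h6, h7⟩ S
    have : S = ∅ ∨ S = {0} ∨ S = {1} ∨ S = {2} ∨ S = {0, 1} ∨ S = {0, 2} ∨ S = {1, 2} ∨
      S = {0, 1, 2} := by revert S; decide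
    rcases this with h | h | h | h | h | h | h | h <;> subst h <;> assumption

theorem sf_ext_iff {A : Type} {F G : SF A} : F = G ↔ F ∅ = G ∅ ∧ F {0} = G {0} ∧ F {1} = G {1} ∧
    F {2} = G {2} ∧ F {0, 1} = G {0, 1} ∧ F {0, 2} = G {0, 2} ∧ F {1, 2} = G {1, 2} ∧
    F {0, 1, 2} = G {0, 1, 2} :=
  funext_iff.trans forall_finset_fin_three

section
variable {A : Type} [CommRing A] (F G H : SF A)

theorem gmul_empty : (F ⋄ G) ∅ = F ∅ * G ∅ := by
  simp [gmul, gsign]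

theorem gmul_0 : (F ⋄ G) {0} = F ∅ * G {0} + F {0} * G ∅ := by
  have h : ({0} : Finset (Fin 3)).powerset = {∅, {0}} := by decide
  simp [gmul, gsign, h]

theorem gmul_1 : (F ⋄ G) {1} = F ∅ * G {1} + F {1} * G ∅ := by
  have h : ({1} : Finset (Fin 3)).powerset = {∅, {1}} := by decide
  simp [gmul, gsign, h]

theorem gmul_2 : (F ⋄ G) {2} = F ∅ * G {2} + F {2} * G ∅ := by
  have h : ({2} : Finset (Fin 3)).powerset = {∅, {2}} := by decide
  simp [gmul, gsign, h]

theorem gmul_01 : (F ⋄ G) {0, 1} =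
    F ∅ * G {0, 1} + F {0} * G {1} - F {1} * G {0} + F {0, 1} * G ∅ := by
  have h : ({0, 1} : Finset (Fin 3)).powerset = {∅, {0}, {1}, {0, 1}} := by decide
  rw [gmul, h, Finset.sum_insert (by decide), Finset.sum_insert (by decide),
    Finset.sum_insert (by decide), Finset.sum_singleton,
    show gsign ∅ (({0, 1} : Finset (Fin 3)) \ ∅) = 1 by decide,
    show gsign {0} (({0, 1} : Finset (Fin 3)) \ {0}) = 1 by decide,
    show gsign {1} (({0, 1} : Finset (Fin 3)) \ {1}) = -1 by decide,
    show gsign {0, 1} (({0, 1} : Finset (Fin 3)) \ {0, 1}) = 1 by decide,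
    show ({0, 1} : Finset (Fin 3)) \ ∅ = {0, 1} by decide,
    show ({0, 1} : Finset (Fin 3)) \ {0} = {1} by decide,
    show ({0, 1} : Finset (Fin 3)) \ {1} = {0} by decide,
    show ({0, 1} : Finset (Fin 3)) \ {0, 1} = ∅ by decide]
  simp only [one_smul, neg_smul]
  ring

theorem gmul_02 : (F ⋄ G) {0, 2} =
    F ∅ * G {0, 2} + F {0} * G {2} - F {2} * G {0} + F {0, 2} * G ∅ := by
  have h : ({0, 2} : Finset (Fin 3)).powerset = {∅, {0}, {2}, {0, 2}} := by decide
  rw [gmul, h, Finset.sum_insert (by decide), Finset.sum_insert (by decide),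
    Finset.sum_insert (by decide), Finset.sum_singleton,
    show gsign ∅ (({0, 2} : Finset (Fin 3)) \ ∅) = 1 by decide,
    show gsign {0} (({0, 2} : Finset (Fin 3)) \ {0}) = 1 by decide,
    show gsign {2} (({0, 2} : Finset (Fin 3)) \ {2}) = -1 by decide,
    show gsign {0, 2} (({0, 2} : Finset (Fin 3)) \ {0, 2}) = 1 by decide,
    show ({0, 2} : Finset (Fin 3)) \ ∅ = {0, 2} by decide,
    show ({0, 2} : Finset (Fin 3)) \ {0} = {2} by decide,
    show ({0, 2} : Finset (Fin 3)) \ {2} = {0} by decide,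
    show ({0, 2} : Finset (Fin 3)) \ {0, 2} = ∅ by decide]
  simp only [one_smul, neg_smul]
  ring

theorem gmul_12 : (F ⋄ G) {1, 2} =
    F ∅ * G {1, 2} + F {1} * G {2} - F {2} * G {1} + F {1, 2} * G ∅ := by
  have h : ({1, 2} : Finset (Fin 3)).powerset = {∅, {1}, {2}, {1, 2}} := by decide
  rw [gmul, h, Finset.sum_insert (by decide), Finset.sum_insert (by decide),
    Finset.sum_insert (by decide), Finset.sum_singleton,
    show gsign ∅ (({1, 2} : Finset (Fin 3)) \ ∅) = 1 by decide,
    show gsign {1} (({1, 2} : Finset (Fin 3)) \ {1}) = 1 by decide,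
    show gsign {2} (({1, 2} : Finset (Fin 3)) \ {2}) = -1 by decide,
    show gsign {1, 2} (({1, 2} : Finset (Fin 3)) \ {1, 2}) = 1 by decide,
    show ({1, 2} : Finset (Fin 3)) \ ∅ = {1, 2} by decide,
    show ({1, 2} : Finset (Fin 3)) \ {1} = {2} by decide,
    show ({1, 2} : Finset (Fin 3)) \ {2} = {1} by decide,
    show ({1, 2} : Finset (Fin 3)) \ {1, 2} = ∅ by decide]
  simp only [one_smul, neg_smul]
  ring

theorem gmul_012 : (F ⋄ G) {0, 1, 2} =
    F ∅ * G {0, 1, 2} + F {0} * G {1, 2} - F {1} * G {0, 2} + F {2} * G {0, 1}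
      + F {0, 1} * G {2} - F {0, 2} * G {1} + F {1, 2} * G {0} + F {0, 1, 2} * G ∅ := by
  have h : ({0, 1, 2} : Finset (Fin 3)).powerset =
    {∅, {0}, {1}, {2}, {0, 1}, {0, 2}, {1, 2}, {0, 1, 2}} := by decide
  rw [gmul, h, Finset.sum_insert (by decide), Finset.sum_insert (by decide),
    Finset.sum_insert (by decide), Finset.sum_insert (by decide), Finset.sum_insert (by decide),
    Finset.sum_insert (by decide), Finset.sum_insert (by decide), Finset.sum_singleton,
    show gsign ∅ (({0, 1, 2} : Finset (Fin 3)) \ ∅) = 1 by decide,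
    show gsign {0} (({0, 1, 2} : Finset (Fin 3)) \ {0}) = 1 by decide,
    show gsign {1} (({0, 1, 2} : Finset (Fin 3)) \ {1}) = -1 by decide,
    show gsign {2} (({0, 1, 2} : Finset (Fin 3)) \ {2}) = 1 by decide,
    show gsign {0, 1} (({0, 1, 2} : Finset (Fin 3)) \ {0, 1}) = 1 by decide,
    show gsign {0, 2} (({0, 1, 2} : Finset (Fin 3)) \ {0, 2}) = -1 by decide,
    show gsign {1, 2} (({0, 1, 2} : Finset (Fin 3)) \ {1, 2}) = 1 by decide,
    show gsign {0, 1, 2} (({0, 1, 2} : Finset (Fin 3)) \ {0, 1, 2}) = 1 by decide,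
    show ({0, 1, 2} : Finset (Fin 3)) \ ∅ = {0, 1, 2} by decide,
    show ({0, 1, 2} : Finset (Fin 3)) \ {0} = {1, 2} by decide,
    show ({0, 1, 2} : Finset (Fin 3)) \ {1} = {0, 2} by decide,
    show ({0, 1, 2} : Finset (Fin 3)) \ {2} = {0, 1} by decide,
    show ({0, 1, 2} : Finset (Fin 3)) \ {0, 1} = {2} by decide,
    show ({0, 1, 2} : Finset (Fin 3)) \ {0, 2} = {1} by decide,
    show ({0, 1, 2} : Finset (Fin 3)) \ {1, 2} = {0} by decide,
    show ({0, 1, 2} : Finset (Fin 3)) \ {0, 1, 2} = ∅ by decide]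
  simp only [one_smul, neg_smul]
  ring

theorem gmul_assoc : F ⋄ G ⋄ H = F ⋄ (G ⋄ H) := by
  refine sf_ext_iff.2 ⟨?_, ?_, ?_, ?_, ?_, ?_, ?_, ?_⟩ <;>
  · simp only [gmul_empty, gmul_0, gmul_1, gmul_2, gmul_01, gmul_02, gmul_12, gmul_012]
    ring

theorem ofFun_gmul (a : A) : ofFun a ⋄ F = fun S => a * F S := by
  funext S
  rw [gmul, Finset.sum_eq_single ∅]
  · simp [ofFun, gsign]
  · intro T _ hT
    simp [ofFun, hT]
  · simp

theorem one_gmul : ofFun 1 ⋄ F = F := by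
  simp [ofFun_gmul]

theorem gmul_ofFun (a : A) : F ⋄ ofFun a = fun S => F S * a := by
  funext S
  rw [gmul, Finset.sum_eq_single S]
  · simp [ofFun, gsign]
  · intro T hT hTS
    have : S \ T ≠ ∅ := by
      rw [Ne, Finset.sdiff_eq_empty_iff_subset]
      exact fun h => hTS (Finset.Subset.antisymm (Finset.mem_powerset.1 hT) h)
    simp [ofFun, this]
  · simp

theorem gmul_one : F ⋄ ofFun 1 = F := by
  simp [gmul_ofFun]

theorem ofFun_gmul_comm (a : A) : ofFun a ⋄ F = F ⋄ ofFun a := by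
  simp [gmul_ofFun, ofFun_gmul, mul_comm]

theorem gmul_zero : F ⋄ 0 = 0 := by
  funext S; simp [gmul]

theorem zero_gmul : 0 ⋄ F = 0 := by
  funext S; simp [gmul]

theorem gmul_neg : F ⋄ (-G) = -(F ⋄ G) := by
  funext S; simp [gmul]

theorem gmul_sub : F ⋄ (G - H) = F ⋄ G - F ⋄ H := by
  rw [sub_eq_add_neg, gmul_add, gmul_neg, sub_eq_add_neg]

theorem neg_gmul : (-F) ⋄ G = -(F ⋄ G) := by
  funext S; simp [gmul]

theorem sub_gmul : (F - G) ⋄ H = F ⋄ H - G ⋄ H := by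
  rw [sub_eq_add_neg, add_gmul, neg_gmul, sub_eq_add_neg]

theorem gmul_sum {ι : Type*} (s : Finset ι) (K : ι → SF A) :
    F ⋄ (∑ i ∈ s, K i) = ∑ i ∈ s, F ⋄ K i :=
  map_sum (AddMonoidHom.mk' (fun K => F ⋄ K) (gmul_add F)) K s

theorem sum_gmul {ι : Type*} (s : Finset ι) (K : ι → SF A) :
    (∑ i ∈ s, K i) ⋄ F = ∑ i ∈ s, K i ⋄ F :=
  map_sum (AddMonoidHom.mk' (fun K => K ⋄ F) (fun a b => add_gmul a b F)) K s

end

/-! ### Signs and parity -/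

/-- The Koszul sign `(-1)^{pq}`. -/
def koszul (p q : ZMod 2) : ℂ := (-1) ^ (p.val * q.val)

theorem zmod_two_cases (p : ZMod 2) : p = 0 ∨ p = 1 := by revert p; decide

theorem koszul_zero_left (q : ZMod 2) : koszul 0 q = 1 := by simp [koszul]
theorem koszul_zero_right (q : ZMod 2) : koszul q 0 = 1 := by simp [koszul]
theorem koszul_one_one : koszul 1 1 = -1 := by simp [koszul, show (1 : ZMod 2).val = 1 from rfl]
theorem one_add_one_zmod : (1 + 1 : ZMod 2) = 0 := by decide

theorem koszul_comm (p q : ZMod 2) : koszul p q = koszul q p := by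
  simp [koszul, mul_comm]

theorem koszul_add_left (p q r : ZMod 2) : koszul (p + q) r = koszul p r * koszul q r := by
  rcases zmod_two_cases p with rfl | rfl <;> rcases zmod_two_cases q with rfl | rfl <;>
  rcases zmod_two_cases r with rfl | rfl <;>
  simp [koszul_zero_left, koszul_zero_right, koszul_one_one, one_add_one_zmod]

theorem koszul_add_right (p q r : ZMod 2) : koszul p (q + r) = koszul p q * koszul p r := by
  rw [koszul_comm, koszul_add_left, koszul_comm q, koszul_comm r]

theorem koszul_mul_self (p q : ZMod 2) : koszul p q * koszul p q = 1 := by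
  rw [← koszul_add_left, CharTwo.add_self_eq_zero, koszul_zero_left]

section
variable {A : Type} [CommRing A] [Algebra ℂ A] {F G H : SF A} {p q : ZMod 2}

theorem mem_sfParity_zero : F ∈ sfParity A 0 ↔
    F {0} = 0 ∧ F {1} = 0 ∧ F {2} = 0 ∧ F {0, 1, 2} = 0 := by
  change (∀ S : Finset (Fin 3), (S.card : ZMod 2) ≠ 0 → F S = 0) ↔ _
  rw [forall_finset_fin_three]
  simp [show (3 : ZMod 2) ≠ 0 by decide,
    show (2 : ZMod 2) = 0 by decide]

theorem mem_sfParity_one : F ∈ sfParity A 1 ↔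
    F ∅ = 0 ∧ F {0, 1} = 0 ∧ F {0, 2} = 0 ∧ F {1, 2} = 0 := by
  change (∀ S : Finset (Fin 3), (S.card : ZMod 2) ≠ 1 → F S = 0) ↔ _
  rw [forall_finset_fin_three]
  simp [show (3 : ZMod 2) = 1 by decide,
    show (2 : ZMod 2) = 0 by decide]

theorem gmul_mem_sfParity (hF : F ∈ sfParity A p) (hG : G ∈ sfParity A q) :
    F ⋄ G ∈ sfParity A (p + q) := by
  rcases zmod_two_cases p with rfl | rfl <;> rcases zmod_two_cases q with rfl | rfl <;>
  simp only [add_zero, zero_add, one_add_one_zmod, mem_sfParity_zero, mem_sfParity_one] at * <;>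
  simp [gmul_empty, gmul_0, gmul_1, gmul_2, gmul_01, gmul_02, gmul_12, gmul_012, hF, hG]

theorem gmul_comm_of_parity (hF : F ∈ sfParity A p) (hG : G ∈ sfParity A q) :
    F ⋄ G = koszul p q • (G ⋄ F) := by
  rcases zmod_two_cases p with rfl | rfl <;> rcases zmod_two_cases q with rfl | rfl <;>
  simp only [mem_sfParity_zero, mem_sfParity_one, koszul_zero_left, koszul_zero_right,
    koszul_one_one, one_smul, neg_smul] at * <;>
  refine sf_ext_iff.2 ⟨?_, ?_, ?_, ?_, ?_, ?_, ?_, ?_⟩ <;>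
  simp only [Pi.neg_apply, gmul_empty, gmul_0, gmul_1, gmul_2, gmul_01, gmul_02, gmul_12, gmul_012,
    hF, hG] <;> ring

theorem dxi_0 (F : SF A) : dxi 0 F ∅ = F {0} ∧ dxi 0 F {0} = 0 ∧ dxi 0 F {1} = F {0, 1} ∧
    dxi 0 F {2} = F {0, 2} ∧ dxi 0 F {0, 1} = 0 ∧ dxi 0 F {0, 2} = 0 ∧
    dxi 0 F {1, 2} = F {0, 1, 2} ∧ dxi 0 F {0, 1, 2} = 0 := by
  refine ⟨?_, ?_, ?_, ?_, ?_, ?_, ?_, ?_⟩ <;> simp [dxi]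
  · simp [gsign]
  · rw [show gsign {0} {1} = 1 by decide]; simp
  · rw [show gsign {0} {2} = 1 by decide]; simp
  · rw [show gsign {0} {1, 2} = 1 by decide]; simp

theorem dxi_1 (F : SF A) : dxi 1 F ∅ = F {1} ∧ dxi 1 F {0} = - F {0, 1} ∧ dxi 1 F {1} = 0 ∧
    dxi 1 F {2} = F {1, 2} ∧ dxi 1 F {0, 1} = 0 ∧ dxi 1 F {0, 2} = - F {0, 1, 2} ∧
    dxi 1 F {1, 2} = 0 ∧ dxi 1 F {0, 1, 2} = 0 := by
  refine ⟨?_, ?_, ?_, ?_, ?_, ?_, ?_, ?_⟩ <;> simp [dxi]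
  · simp [gsign]
  · rw [show gsign {1} {0} = -1 by decide, show ({1, 0} : Finset (Fin 3)) = {0, 1} by decide]; simp
  · rw [show gsign {1} {2} = 1 by decide]; simp
  · rw [show gsign {1} {0, 2} = -1 by decide,
      show ({1, 0, 2} : Finset (Fin 3)) = {0, 1, 2} by decide]; simp

theorem dxi_2 (F : SF A) : dxi 2 F ∅ = F {2} ∧ dxi 2 F {0} = - F {0, 2} ∧
    dxi 2 F {1} = - F {1, 2} ∧ dxi 2 F {2} = 0 ∧ dxi 2 F {0, 1} = F {0, 1, 2} ∧
    dxi 2 F {0, 2} = 0 ∧ dxi 2 F {1, 2} = 0 ∧ dxi 2 F {0, 1, 2} = 0 := by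
  refine ⟨?_, ?_, ?_, ?_, ?_, ?_, ?_, ?_⟩ <;> simp [dxi]
  · simp [gsign]
  · rw [show gsign {2} {0} = -1 by decide, show ({2, 0} : Finset (Fin 3)) = {0, 2} by decide]; simp
  · rw [show gsign {2} {1} = -1 by decide, show ({2, 1} : Finset (Fin 3)) = {1, 2} by decide]; simp
  · rw [show gsign {2} {0, 1} = 1 by decide,
      show ({2, 0, 1} : Finset (Fin 3)) = {0, 1, 2} by decide]; simp

theorem dxi_mem_sfParity (i : Fin 3) (hF : F ∈ sfParity A p) : dxi i F ∈ sfParity A (p + 1) := by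
  rcases zmod_two_cases p with rfl | rfl <;> fin_cases i <;>
  simp only [zero_add, one_add_one_zmod, mem_sfParity_zero, mem_sfParity_one] at * <;>
  simp [dxi_0, dxi_1, dxi_2, hF]

theorem dxi_gmul (i : Fin 3) (hF : F ∈ sfParity A p) (G : SF A) :
    dxi i (F ⋄ G) = dxi i F ⋄ G + koszul 1 p • (F ⋄ dxi i G) := by
  rcases zmod_two_cases p with rfl | rfl <;>
  simp only [mem_sfParity_zero, mem_sfParity_one, koszul_zero_right,
    koszul_one_one, one_smul, neg_smul] at * <;>
  fin_cases i <;>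
  refine sf_ext_iff.2 ⟨?_, ?_, ?_, ?_, ?_, ?_, ?_, ?_⟩ <;>
  simp only [Fin.zero_eta, Fin.mk_one, Fin.reduceFinMk, Pi.neg_apply, Pi.add_apply, gmul_empty,
    gmul_0, gmul_1, gmul_2, gmul_01, gmul_02, gmul_12, gmul_012, dxi_0, dxi_1, dxi_2, hF] <;> ring

theorem dxi_dxi (i j : Fin 3) (F : SF A) : dxi i (dxi j F) = - dxi j (dxi i F) := by
  fin_cases i <;> fin_cases j <;>
  refine sf_ext_iff.2 ⟨?_, ?_, ?_, ?_, ?_, ?_, ?_, ?_⟩ <;>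
  simp [dxi_0, dxi_1, dxi_2]

theorem sfComp_mem (p : ZMod 2) (F : SF A) : sfComp p F ∈ sfParity A p := by
  intro S hS
  simp [sfComp, hS]

theorem sfComp_of_mem (hF : F ∈ sfParity A p) : sfComp p F = F := by
  funext S
  by_cases h : (S.card : ZMod 2) = p
  · simp [sfComp, h]
  · simp [sfComp, h, hF S h]

theorem sfComp_of_mem_ne (hF : F ∈ sfParity A p) (hpq : p ≠ q) : sfComp q F = 0 := by
  funext S
  by_cases h : (S.card : ZMod 2) = q
  · simp [sfComp, h, hF S (h.trans_ne hpq.symm)]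
  · simp [sfComp, h]

theorem sfComp_zero_add_one (F : SF A) : sfComp 0 F + sfComp 1 F = F := by
  funext S
  rcases zmod_two_cases (S.card : ZMod 2) with h | h <;> simp [sfComp, h]

theorem mem_sfParity_iff : F ∈ sfParity A p ↔ sfComp p F = F :=
  ⟨sfComp_of_mem, fun h => h ▸ sfComp_mem p F⟩

theorem ofFun_mem_sfParity (a : A) : ofFun a ∈ sfParity A 0 := by
  simp [mem_sfParity_zero, ofFun]

theorem xi_mem_sfParity (i : Fin 3) : xi A i ∈ sfParity A 1 := by
  rw [mem_sfParity_one]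
  fin_cases i <;> refine ⟨?_, ?_, ?_, ?_⟩ <;> exact Pi.single_eq_of_ne (by decide) _

theorem dxi_ofFun (i : Fin 3) (a : A) : dxi i (ofFun a) = 0 := by
  funext S
  simp [dxi, ofFun]

theorem dxi_xi (i j : Fin 3) : dxi i (xi A j) = if i = j then ofFun 1 else 0 := by
  fin_cases i <;> fin_cases j <;>
  refine sf_ext_iff.2 ⟨?_, ?_, ?_, ?_, ?_, ?_, ?_, ?_⟩ <;>
  simp [dxi_0, dxi_1, dxi_2, xi, ofFun, Pi.single_apply] <;>
  exact fun h => absurd h (by decide)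

end

/-! ### Coordinate derivations -/

section
variable {U : Opens (Fin 3 → ℂ)}

theorem pderiv_apply (i : Fin 3) (f : holo U) (x : U) :
    (pderiv U i f).1 x = fderiv ℂ (zeroExt U f.1) x (Pi.single i 1) := rfl

theorem pderiv_mul (i : Fin 3) (f g : holo U) :
    pderiv U i (f * g) = pderiv U i f * g + f * pderiv U i g := by
  ext x
  have hf := (f.2 x.1 x.2).differentiableAt
  have hg := (g.2 x.1 x.2).differentiableAt
  have h : (pderiv U i (f * g)).1 x = (pderiv U i f).1 x * g.1 x + f.1 x * (pderiv U i g).1 x := by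
    simp only [pderiv_apply, Subalgebra.coe_mul, zeroExt_mul]
    rw [fderiv_mul hf hg]
    simp [zeroExt_of_mem U _ x.2]
    ring
  exact h

/-- Both sides are values of the second Fréchet derivative, which is symmetric for an analytic
function. -/
theorem pderiv_comm (i j : Fin 3) (f : holo U) :
    pderiv U i (pderiv U j f) = pderiv U j (pderiv U i f) := by
  have key : ∀ (i j : Fin 3) (x : U), (pderiv U i (pderiv U j f)).1 x =
      fderiv ℂ (fderiv ℂ (zeroExt U f.1)) x (Pi.single i 1) (Pi.single j 1) := by
    intro i j x
    have h1 : zeroExt U (pderiv U j f).1 =ᶠ[nhds x.1]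
        fun z => fderiv ℂ (zeroExt U f.1) z (Pi.single j 1) :=
      zeroExt_restrict_eventuallyEq U
        (fun z => fderiv ℂ (zeroExt U f.1) z (Pi.single j 1)) x.2
    rw [pderiv_apply, h1.fderiv_eq]
    have h2 := (AnalyticAt.fderiv (f.2 x.1 x.2)).differentiableAt
    rw [fderiv_clm_apply h2 (differentiableAt_const _)]
    simp
  ext x
  refine (key i j x).trans (Eq.trans ?_ (key j i x).symm)
  have h := (AnalyticAt.contDiffAt (n := 2) (f.2 x.1 x.2)).isSymmSndFDerivAt (by simp)
  exact h _ _

theorem pderiv_coordFun (i j : Fin 3) :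
    pderiv U i (coordFun U j) = if i = j then 1 else 0 := by
  ext x
  have h : (pderiv U i (coordFun U j)).1 x = if i = j then 1 else 0 := by
    have h1 : zeroExt U (coordFun U j).1 =ᶠ[nhds x.1] fun z => z j :=
      zeroExt_restrict_eventuallyEq U (fun z => z j) x.2
    rw [pderiv_apply, h1.fderiv_eq]
    have h2 : fderiv ℂ (fun z : Fin 3 → ℂ => z j) x = ContinuousLinearMap.proj j :=
      (ContinuousLinearMap.proj (R := ℂ) (φ := fun _ : Fin 3 => ℂ) j).fderiv
    rw [h2]
    simp [Pi.single_apply, eq_comm]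
  refine h.trans ?_
  split_ifs <;> rfl

theorem pderiv_one (i : Fin 3) : pderiv U i 1 = 0 := by
  have h := pderiv_mul i (1 : holo U) 1
  simpa using h

theorem pd_inl_apply (i : Fin 3) (F : SFun U) (S : Finset (Fin 3)) :
    pd U (Sum.inl i) F S = pderiv U i (F S) := rfl

theorem pd_inr (i : Fin 3) (F : SFun U) : pd U (Sum.inr i) F = dxi i F := rfl

theorem pd_inl_gmul (i : Fin 3) (F G : SFun U) :
    pd U (Sum.inl i) (F ⋄ G) = pd U (Sum.inl i) F ⋄ G + F ⋄ pd U (Sum.inl i) G := by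
  funext S
  simp only [Pi.add_apply, gmul, pd_inl_apply, map_sum, map_zsmul, pderiv_mul, smul_add,
    Finset.sum_add_distrib]

theorem pd_gmul (A : Idx) {p : ZMod 2} {F : SFun U} (hF : F ∈ sfParity (holo U) p) (G : SFun U) :
    pd U A (F ⋄ G) = pd U A F ⋄ G + koszul (idxParity A) p • (F ⋄ pd U A G) := by
  rcases A with i | i
  · rw [idxParity, koszul_zero_left, one_smul, pd_inl_gmul]
  · exact dxi_gmul i hF G

theorem pd_mem_sfParity (A : Idx) {p : ZMod 2} {F : SFun U} (hF : F ∈ sfParity (holo U) p) :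
    pd U A F ∈ sfParity (holo U) (p + idxParity A) := by
  rcases A with i | i
  · intro S hS
    rw [idxParity, add_zero] at hS
    rw [pd_inl_apply, hF S hS, map_zero]
  · exact dxi_mem_sfParity i hF

theorem pd_inl_dxi (i j : Fin 3) (F : SFun U) :
    pd U (Sum.inl i) (dxi j F) = dxi j (pd U (Sum.inl i) F) := by
  funext S
  rw [pd_inl_apply]
  by_cases h : j ∈ S
  · simp [dxi, h]
  · simp only [dxi, LinearMap.coe_mk, AddHom.coe_mk, if_neg h, map_zsmul, pd_inl_apply]

theorem pd_pd (A B : Idx) (F : SFun U) :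
    pd U A (pd U B F) = koszul (idxParity A) (idxParity B) • pd U B (pd U A F) := by
  rcases A with i | i <;> rcases B with j | j <;>
  simp only [idxParity, koszul_zero_left, koszul_zero_right, koszul_one_one, one_smul]
  · funext S
    simp only [pd_inl_apply, pderiv_comm i j]
  · exact pd_inl_dxi i j F
  · exact (pd_inl_dxi j i F).symm
  · exact (dxi_dxi i j F).trans (neg_one_smul ℂ _).symm

/-! ### Vector fields as superderivations -/

theorem act_zero_right (X : VF U) : act X 0 = 0 := by
  simpa using act_smul_right (0 : ℂ) X 0

theorem act_zero_left (F : SFun U) : act (0 : VF U) F = 0 := by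
  simpa using act_smul_left (0 : ℂ) (0 : VF U) F

theorem act_neg_right (X : VF U) (F : SFun U) : act X (-F) = - act X F := by
  have h := act_smul_right (-1 : ℂ) X F
  rwa [neg_one_smul ℂ F, neg_one_smul ℂ (act X F)] at h

theorem act_sub_right (X : VF U) (F G : SFun U) : act X (F - G) = act X F - act X G := by
  rw [sub_eq_add_neg, act_add_right, act_neg_right, sub_eq_add_neg]

theorem act_sum_right {ι : Type*} (s : Finset ι) (X : VF U) (K : ι → SFun U) :
    act X (∑ i ∈ s, K i) = ∑ i ∈ s, act X (K i) :=
  map_sum (AddMonoidHom.mk' (act X) (act_add_right X)) K s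

theorem act_bas (A : Idx) (F : SFun U) : act (bas U A) F = pd U A F := by
  rw [act, Finset.sum_eq_single A]
  · simp [bas, one_gmul]
  · intro B _ hB
    simp [bas, Pi.single_eq_of_ne hB, zero_gmul]
  · simp

theorem act_fmul (F : SFun U) (X : VF U) (G : SFun U) : act (F ⊡ X) G = F ⋄ act X G := by
  simp only [act, gmul_sum, fmul, gmul_assoc]

theorem parity_cancel (p q a : ZMod 2) : p + a + (q + a) = p + q := by
  revert p q a; decide

variable {p q r : ZMod 2} {X Y Z : VF U} {F G : SFun U}

theorem act_mem_sfParity (hX : X ∈ vfParity U p) (hF : F ∈ sfParity (holo U) q) :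
    act X F ∈ sfParity (holo U) (p + q) := by
  refine Submodule.sum_mem _ fun A _ => ?_
  have h := gmul_mem_sfParity (hX A) (pd_mem_sfParity A hF)
  rwa [parity_cancel] at h

/-- Two signs meet in the term of ∂_A: moving ∂_A past F and moving X_A past F. Their parts
depending on the parity of A cancel, since a Koszul sign squares to 1, and only the sign for the
parities of X and F survives. -/
theorem act_gmul (hX : X ∈ vfParity U p) (hF : F ∈ sfParity (holo U) q) (G : SFun U) :
    act X (F ⋄ G) = act X F ⋄ G + koszul p q • (F ⋄ act X G) := by
  simp only [act, sum_gmul, gmul_sum, Finset.smul_sum, ← Finset.sum_add_distrib]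
  refine Finset.sum_congr rfl fun A _ => ?_
  rw [pd_gmul A hF, gmul_add, gmul_smul, ← gmul_assoc, ← gmul_assoc,
    gmul_comm_of_parity (hX A) hF, smul_gmul, smul_smul, gmul_assoc F, koszul_add_left,
    mul_left_comm, koszul_mul_self, mul_one]

theorem vfComp_mem (p : ZMod 2) (X : VF U) : vfComp p X ∈ vfParity U p :=
  fun A => sfComp_mem _ (X A)

theorem vfComp_of_mem (hX : X ∈ vfParity U p) : vfComp p X = X := by
  funext A
  exact sfComp_of_mem (hX A)

theorem vfComp_of_mem_ne (hX : X ∈ vfParity U p) (hpq : p ≠ q) : vfComp q X = 0 := by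
  funext A
  exact sfComp_of_mem_ne (hX A) (fun h => hpq (add_right_cancel h))

theorem vfComp_zero_add_one (X : VF U) : vfComp 0 X + vfComp 1 X = X := by
  funext A
  rcases A with i | i
  · simp only [Pi.add_apply, vfComp, idxParity, add_zero, sfComp_zero_add_one]
  · simp only [Pi.add_apply, vfComp, idxParity, zero_add, one_add_one_zmod]
    rw [add_comm, sfComp_zero_add_one]

theorem sum_zmod_two {M : Type*} [AddCommMonoid M] (k : ZMod 2 → M) : ∑ p, k p = k 0 + k 1 :=
  Fin.sum_univ_two k

theorem bracket_apply (hX : X ∈ vfParity U p) (hY : Y ∈ vfParity U q) (A : Idx) :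
    bracket X Y A = act X (Y A) - koszul p q • act Y (X A) := by
  have h : ∀ (p' q' : ZMod 2), ¬ (p = p' ∧ q = q') →
      act (vfComp p' X) (vfComp q' Y A)
        - (-1 : ℂ) ^ (p'.val * q'.val) • act (vfComp q' Y) (vfComp p' X A) = 0 := by
    intro p' q' h
    by_cases hp : p = p'
    · have hq : q ≠ q' := fun hq => h ⟨hp, hq⟩
      simp [vfComp_of_mem_ne hY hq, act_zero_right, act_zero_left]
    · simp [vfComp_of_mem_ne hX hp, act_zero_right, act_zero_left]
  rw [bracket, Finset.sum_eq_single p, Finset.sum_eq_single q, vfComp_of_mem hX, vfComp_of_mem hY]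
  · rfl
  · exact fun q' _ hq => h p q' fun hh => hq hh.2.symm
  · simp
  · exact fun p' _ hp => Finset.sum_eq_zero fun q' _ => h p' q' fun hh => hp hh.1.symm
  · simp

theorem bracket_mem_vfParity (hX : X ∈ vfParity U p) (hY : Y ∈ vfParity U q) :
    bracket X Y ∈ vfParity U (p + q) := by
  intro A
  rw [bracket_apply hX hY]
  refine Submodule.sub_mem _ ?_ (Submodule.smul_mem _ _ ?_)
  · rw [add_assoc]
    exact act_mem_sfParity hX (hY A)
  · rw [add_comm p, add_assoc]
    exact act_mem_sfParity hY (hX A)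

theorem bracket_add_right (X Y Z : VF U) : bracket X (Y + Z) = bracket X Y + bracket X Z := by
  funext A
  simp only [bracket, vfComp_add, act_add_left, act_add_right, Pi.add_apply, smul_add,
    ← Finset.sum_add_distrib]
  refine Finset.sum_congr rfl fun p _ => Finset.sum_congr rfl fun q _ => ?_
  abel

theorem bracket_smul_right (c : ℂ) (X Z : VF U) : bracket X (c • Z) = c • bracket X Z := by
  funext A
  simp only [bracket, vfComp_smul, act_smul_left, act_smul_right, Pi.smul_apply,
    Finset.smul_sum, smul_sub]
  refine Finset.sum_congr rfl fun p _ => Finset.sum_congr rfl fun q _ => ?_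
  rw [smul_comm c]

theorem bracket_zero_right (X : VF U) : bracket X 0 = 0 := by
  simpa using bracket_smul_right (0 : ℂ) X 0

/-- The bracket adds parities, so against a homogeneous Y only the component of X of parity p lands
in parity p + q. -/
theorem vfComp_bracket (p q : ZMod 2) (X Y : VF U) (hY : Y ∈ vfParity U q) :
    vfComp (p + q) (bracket X Y) = bracket (vfComp p X) Y := by
  have h : ∀ p' : ZMod 2, p' ≠ p → vfComp (p + q) (bracket (vfComp p' X) Y) = 0 := fun p' hp =>
    vfComp_of_mem_ne (bracket_mem_vfParity (vfComp_mem p' X) hY) fun h => hp (add_right_cancel h)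
  have h' := vfComp_of_mem (bracket_mem_vfParity (vfComp_mem p X) hY)
  conv_lhs => rw [← vfComp_zero_add_one X, bracket_add_left, vfComp_add]
  rcases zmod_two_cases p with rfl | rfl
  · rw [h', h 1 (by decide), add_zero]
  · rw [h', h 0 (by decide), zero_add]

theorem bracket_fmul_right (hX : X ∈ vfParity U p) (hF : F ∈ sfParity (holo U) q)
    (hZ : Z ∈ vfParity U r) :
    bracket X (F ⊡ Z) = act X F ⊡ Z + koszul p q • (F ⊡ bracket X Z) := by
  have hFZ : F ⊡ Z ∈ vfParity U (q + r) := fun A => by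
    rw [add_assoc]; exact gmul_mem_sfParity hF (hZ A)
  funext A
  rw [bracket_apply hX hFZ, act_fmul, Pi.add_apply, Pi.smul_apply]
  simp only [fmul]
  rw [bracket_apply hX hZ, act_gmul hX hF, gmul_sub, gmul_smul, koszul_add_right, smul_sub,
    smul_smul, add_sub_assoc]

/-- In the supercommutator of two first-order operators the second-order parts cancel, because
coordinate derivations supercommute. What remains has the coefficients of `bracket`. -/
theorem act_bracket (hX : X ∈ vfParity U p) (hY : Y ∈ vfParity U q) (F : SFun U) :
    act (bracket X Y) F = act X (act Y F) - koszul p q • act Y (act X F) := by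
  have expand : ∀ {p q : ZMod 2} {X Y : VF U}, X ∈ vfParity U p → Y ∈ vfParity U q →
      act X (act Y F) = ∑ A, act X (Y A) ⋄ pd U A F +
        ∑ A, ∑ B, koszul p (q + idxParity A) • (Y A ⋄ (X B ⋄ pd U B (pd U A F))) := by
    intro p q X Y hX hY
    conv_lhs => rw [act.eq_def Y, act_sum_right]
    rw [← Finset.sum_add_distrib]
    refine Finset.sum_congr rfl fun A _ => ?_
    rw [act_gmul hX (hY A), act.eq_def X (pd U A F), gmul_sum, Finset.smul_sum]
  -- The cancellation of second-order parts: exchange A and B, then commute the coefficients and the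
  -- two derivations. The accumulated signs reduce by squaring to 1.
  have cross : ∑ A, ∑ B, koszul p (q + idxParity A) • (Y A ⋄ (X B ⋄ pd U B (pd U A F))) =
      koszul p q • ∑ A, ∑ B, koszul q (p + idxParity A) • (X A ⋄ (Y B ⋄ pd U B (pd U A F))) := by
    rw [Finset.sum_comm, Finset.smul_sum]
    refine Finset.sum_congr rfl fun B _ => ?_
    rw [Finset.smul_sum]
    refine Finset.sum_congr rfl fun A _ => ?_
    rw [← gmul_assoc, gmul_comm_of_parity (hY A) (hX B), pd_pd B A, gmul_smul, smul_gmul,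
      smul_smul, smul_smul, smul_smul, gmul_assoc]
    congr 1
    simp only [koszul_add_right, koszul_add_left]
    rw [koszul_comm q p, koszul_comm (idxParity A) p, koszul_comm (idxParity A) (idxParity B)]
    linear_combination (koszul p q * koszul p q * koszul q (idxParity B)) *
      (koszul_mul_self p (idxParity A)) * (koszul (idxParity B) (idxParity A) ^ 2) +
      (koszul p q * koszul p q * koszul q (idxParity B)) * (koszul_mul_self (idxParity B) (idxParity A))
  rw [expand hX hY, expand hY hX, cross, act.eq_def]
  simp only [bracket_apply hX hY, sub_gmul, smul_gmul, Finset.sum_sub_distrib, ← Finset.smul_sum]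
  rw [smul_add]
  abel

/-- Taken one coefficient at a time, `act_bracket` turns every iterated bracket into iterated
actions on the coefficients of X, Y, Z. The two sides then agree term by term up to Koszul signs. -/
theorem bracket_jacobi (hX : X ∈ vfParity U p) (hY : Y ∈ vfParity U q) (hZ : Z ∈ vfParity U r) :
    bracket (bracket X Y) Z = bracket X (bracket Y Z) - koszul p q • bracket Y (bracket X Z) := by
  funext A
  rw [bracket_apply (bracket_mem_vfParity hX hY) hZ, Pi.sub_apply, Pi.smul_apply,
    bracket_apply hX (bracket_mem_vfParity hY hZ), bracket_apply hY (bracket_mem_vfParity hX hZ),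
    act_bracket hX hY, act_bracket hY hZ, act_bracket hX hZ, bracket_apply hX hY,
    bracket_apply hX hZ, bracket_apply hY hZ]
  simp only [act_sub_right, act_smul_right, koszul_add_left, koszul_add_right, koszul_comm q p]
  have h1 := koszul_mul_self p q
  simp only [smul_sub, smul_smul]
  match_scalars
  · ring
  · ring
  · linear_combination (koszul p r * koszul q r) * h1
  · ring
  · linear_combination -koszul q r * h1
  · ring

end

/-! ### The frame -/

section
variable {U : Opens (Fin 3 → ℂ)}

theorem bas_apply (A B : Idx) : bas U A B = if B = A then ofFun 1 else 0 := by
  rw [bas, Pi.single_apply]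

theorem forall_idx {P : Idx → Prop} : (∀ A, P A) ↔ P (Sum.inl 0) ∧ P (Sum.inl 1) ∧ P (Sum.inl 2) ∧
    P (Sum.inr 0) ∧ P (Sum.inr 1) ∧ P (Sum.inr 2) := by
  simp only [Sum.forall, Fin.forall_fin_succ, and_assoc]
  simp

theorem f_zero_apply : f U 0 (Sum.inl 0) = 0 ∧ f U 0 (Sum.inl 1) = 0 ∧
    f U 0 (Sum.inl 2) = xi (holo U) 1 ∧ f U 0 (Sum.inr 0) = ofFun 1 ∧ f U 0 (Sum.inr 1) = 0 ∧
    f U 0 (Sum.inr 2) = ofFun (coordFun U 0) := by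
  simp [f, f1, fmul, bas_apply, gmul_one, gmul_zero, coord]

theorem f_one_apply : f U 1 (Sum.inl 0) = 0 ∧ f U 1 (Sum.inl 1) = 0 ∧
    f U 1 (Sum.inl 2) = xi (holo U) 0 ∧ f U 1 (Sum.inr 0) = 0 ∧ f U 1 (Sum.inr 1) = ofFun 1 ∧
    f U 1 (Sum.inr 2) = ofFun (coordFun U 1) := by
  simp [f, f2, fmul, bas_apply, gmul_one, gmul_zero, coord]

theorem f_two_apply : f U 2 (Sum.inl 0) = 0 ∧ f U 2 (Sum.inl 1) = 0 ∧ f U 2 (Sum.inl 2) = 0 ∧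
    f U 2 (Sum.inr 0) = 0 ∧ f U 2 (Sum.inr 1) = 0 ∧ f U 2 (Sum.inr 2) = ofFun 1 := by
  simp [f, bas_apply]

theorem f_two : f U 2 = bas U (Sum.inr 2) := rfl

theorem bas_mem_vfParity (A : Idx) : bas U A ∈ vfParity U (idxParity A) := by
  intro B
  rw [bas_apply]
  split_ifs with h
  · rw [h, CharTwo.add_self_eq_zero]
    exact ofFun_mem_sfParity 1
  · exact Submodule.zero_mem _

theorem e_mem_vfParity (i : Fin 3) : e U i ∈ vfParity U 0 := bas_mem_vfParity (Sum.inl i)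

theorem f_zero_mem_vfParity : f U 0 ∈ vfParity U 1 := by
  refine forall_idx.2 ?_
  simp only [f_zero_apply, idxParity, one_add_one_zmod, add_zero]
  exact ⟨Submodule.zero_mem _, Submodule.zero_mem _, xi_mem_sfParity 1, ofFun_mem_sfParity _,
    Submodule.zero_mem _, ofFun_mem_sfParity _⟩

theorem f_one_mem_vfParity : f U 1 ∈ vfParity U 1 := by
  refine forall_idx.2 ?_
  simp only [f_one_apply, idxParity, one_add_one_zmod, add_zero]
  exact ⟨Submodule.zero_mem _, Submodule.zero_mem _, xi_mem_sfParity 0, Submodule.zero_mem _,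
    ofFun_mem_sfParity _, ofFun_mem_sfParity _⟩

theorem f_mem_vfParity (i : Fin 3) : f U i ∈ vfParity U 1 := by
  fin_cases i
  · exact f_zero_mem_vfParity
  · exact f_one_mem_vfParity
  · exact bas_mem_vfParity (Sum.inr 2)

theorem act_e (i : Fin 3) (F : SFun U) : act (e U i) F = pd U (Sum.inl i) F := act_bas _ _

theorem act_eq_sum (X : VF U) (F : SFun U) : act X F =
    X (Sum.inl 0) ⋄ pd U (Sum.inl 0) F + X (Sum.inl 1) ⋄ pd U (Sum.inl 1) F +
    X (Sum.inl 2) ⋄ pd U (Sum.inl 2) F + X (Sum.inr 0) ⋄ dxi 0 F + X (Sum.inr 1) ⋄ dxi 1 F +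
    X (Sum.inr 2) ⋄ dxi 2 F := by
  rw [act, Fintype.sum_sum_type, Fin.sum_univ_three, Fin.sum_univ_three]
  simp only [pd_inr, add_assoc]

theorem act_f_zero (F : SFun U) : act (f U 0) F =
    xi (holo U) 1 ⋄ pd U (Sum.inl 2) F + dxi 0 F + ofFun (coordFun U 0) ⋄ dxi 2 F := by
  simp only [act_eq_sum, f_zero_apply, zero_gmul, one_gmul, zero_add, add_zero]

theorem act_f_one (F : SFun U) : act (f U 1) F =
    xi (holo U) 0 ⋄ pd U (Sum.inl 2) F + dxi 1 F + ofFun (coordFun U 1) ⋄ dxi 2 F := by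
  simp only [act_eq_sum, f_one_apply, zero_gmul, one_gmul, zero_add, add_zero]

theorem pd_inl_ofFun (i : Fin 3) (a : holo U) :
    pd U (Sum.inl i) (ofFun a) = ofFun (pderiv U i a) := by
  funext S
  rw [pd_inl_apply]
  by_cases h : S = ∅ <;> simp [ofFun, h]

theorem pd_inl_xi (i j : Fin 3) : pd U (Sum.inl i) (xi (holo U) j) = 0 := by
  funext S
  rw [pd_inl_apply]
  by_cases h : S = {j} <;> simp [xi, h, pderiv_one]

theorem ofFun_zero : (ofFun 0 : SFun U) = 0 := Pi.single_zero _

theorem act_ofFun_one (X : VF U) : act X (ofFun 1) = 0 := by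
  simp [act_eq_sum, pd_inl_ofFun, pderiv_one, dxi_ofFun, ofFun_zero, gmul_zero]

theorem act_ofFun_coordFun (X : VF U) (i : Fin 3) :
    act X (ofFun (coordFun U i)) = X (Sum.inl i) := by
  fin_cases i <;>
  simp [act_eq_sum, pd_inl_ofFun, pderiv_coordFun, dxi_ofFun, ofFun_zero, gmul_zero, gmul_one]

theorem act_xi (X : VF U) (i : Fin 3) : act X (xi (holo U) i) = X (Sum.inr i) := by
  fin_cases i <;>
  simp [act_eq_sum, pd_inl_xi, dxi_xi, gmul_zero, gmul_one]

theorem act_bas_apply (X : VF U) (A B : Idx) : act X (bas U A B) = 0 := by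
  rw [bas_apply]
  split_ifs
  · exact act_ofFun_one X
  · exact act_zero_right X

theorem bracket_e (p : ZMod 2) {X : VF U} (hX : X ∈ vfParity U p) (i : Fin 3) (A : Idx) :
    bracket X (e U i) A = - pd U (Sum.inl i) (X A) := by
  rw [bracket_apply hX (e_mem_vfParity i), e, act_bas_apply, koszul_zero_right, one_smul, zero_sub,
    act_bas]

theorem structure_relations :
    bracket (e U 0) (f U 0) = f U 2 ∧ bracket (e U 1) (f U 1) = f U 2 ∧
      bracket (f U 0) (f U 1) = (2 : ℂ) • e U 2 ∧
      (∀ i j, bracket (e U i) (e U j) = 0) ∧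
      (∀ i j, ¬ (i = j ∧ i ≠ 2) → bracket (e U i) (f U j) = 0) ∧
      (∀ i j, ¬ (i = 0 ∧ j = 1) → ¬ (i = 1 ∧ j = 0) → bracket (f U i) (f U j) = 0) := by
  have hef : ∀ i j A, bracket (e U i) (f U j) A = pd U (Sum.inl i) (f U j A) := by
    intro i j A
    rw [bracket_apply (e_mem_vfParity i) (f_mem_vfParity j), e, act_bas_apply, act_bas, smul_zero,
      sub_zero]
  have hff : ∀ i j A, bracket (f U i) (f U j) A =
      act (f U i) (f U j A) + act (f U j) (f U i A) := by
    intro i j A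
    rw [bracket_apply (f_mem_vfParity i) (f_mem_vfParity j), koszul_one_one]
    exact (congrArg _ (neg_one_smul ℂ _)).trans (sub_neg_eq_add _ _)
  refine ⟨?_, ?_, ?_, ?_, ?_, ?_⟩
  · refine funext (forall_idx.2 ?_)
    simp [hef, f_zero_apply, f_two, bas_apply, pd_inl_ofFun, pd_inl_xi, pderiv_coordFun, pderiv_one,
      ofFun_zero]
  · refine funext (forall_idx.2 ?_)
    simp [hef, f_one_apply, f_two, bas_apply, pd_inl_ofFun, pd_inl_xi, pderiv_coordFun, pderiv_one,
      ofFun_zero]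
  · refine funext (forall_idx.2 ?_)
    simp only [hff, Pi.smul_apply, f_zero_apply, f_one_apply, act_zero_right, act_ofFun_one,
      act_ofFun_coordFun, act_xi, e, bas_apply]
    simp [two_smul]
  · intro i j
    funext A
    rw [bracket_e 0 (e_mem_vfParity i), e, ← act_e, act_bas_apply, neg_zero]
    rfl
  · intro i j hij
    refine funext (forall_idx.2 ?_)
    fin_cases i <;> fin_cases j <;> simp at hij <;>
    simp [hef, f_zero_apply, f_one_apply, f_two_apply, pd_inl_ofFun, pd_inl_xi,
      pderiv_coordFun, pderiv_one, ofFun_zero]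
  · intro i j h1 h2
    refine funext (forall_idx.2 ?_)
    fin_cases i <;> fin_cases j <;> simp at h1 h2 <;>
    simp [hff, f_zero_apply, f_one_apply, f_two_apply, act_zero_right, act_ofFun_one,
      act_ofFun_coordFun, act_xi]

/-! ### The distribution in terms of coefficients -/

/-- The coefficient at `e₃` of a vector field in the frame `e₁, e₂, e₃ | f₁, f₂, f₃`. -/
def hCoeff (U : Opens (Fin 3 → ℂ)) : VF U →ₗ[ℂ] SFun U where
  toFun X := X (Sum.inl 2) - X (Sum.inr 0) ⋄ xi (holo U) 1 - X (Sum.inr 1) ⋄ xi (holo U) 0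
  map_add' X Y := by
    simp only [Pi.add_apply, add_gmul]
    abel
  map_smul' c X := by
    simp only [Pi.smul_apply, smul_gmul, smul_sub, RingHom.id_apply]

/-- The coefficient at `f₃` of a vector field in the frame `e₁, e₂, e₃ | f₁, f₂, f₃`. -/
def gCoeff (U : Opens (Fin 3 → ℂ)) : VF U →ₗ[ℂ] SFun U where
  toFun X := X (Sum.inr 2) - X (Sum.inr 0) ⋄ ofFun (coordFun U 0)
    - X (Sum.inr 1) ⋄ ofFun (coordFun U 1)
  map_add' X Y := by
    simp only [Pi.add_apply, add_gmul]
    abel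
  map_smul' c X := by
    simp only [Pi.smul_apply, smul_gmul, smul_sub, RingHom.id_apply]

theorem hCoeff_apply (X : VF U) : hCoeff U X =
    X (Sum.inl 2) - X (Sum.inr 0) ⋄ xi (holo U) 1 - X (Sum.inr 1) ⋄ xi (holo U) 0 := rfl

theorem gCoeff_apply (X : VF U) : gCoeff U X = X (Sum.inr 2) -
    X (Sum.inr 0) ⋄ ofFun (coordFun U 0) - X (Sum.inr 1) ⋄ ofFun (coordFun U 1) := rfl

theorem hCoeff_fmul (F : SFun U) (X : VF U) : hCoeff U (F ⊡ X) = F ⋄ hCoeff U X := by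
  simp only [hCoeff_apply, fmul, gmul_assoc, gmul_sub]

theorem gCoeff_fmul (F : SFun U) (X : VF U) : gCoeff U (F ⊡ X) = F ⋄ gCoeff U X := by
  simp only [gCoeff_apply, fmul, gmul_assoc, gmul_sub]

theorem hCoeff_frame : hCoeff U (e U 0) = 0 ∧ hCoeff U (e U 1) = 0 ∧ hCoeff U (e U 2) = ofFun 1 ∧
    hCoeff U (f U 0) = 0 ∧ hCoeff U (f U 1) = 0 ∧ hCoeff U (f U 2) = 0 := by
  simp only [hCoeff_apply, f_zero_apply, f_one_apply, e, f_two, bas_apply, zero_gmul, one_gmul]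
  simp [zero_gmul]

theorem gCoeff_frame : gCoeff U (e U 0) = 0 ∧ gCoeff U (e U 1) = 0 ∧ gCoeff U (e U 2) = 0 ∧
    gCoeff U (f U 0) = 0 ∧ gCoeff U (f U 1) = 0 ∧ gCoeff U (f U 2) = ofFun 1 := by
  simp only [gCoeff_apply, f_zero_apply, f_one_apply, e, f_two, bas_apply, zero_gmul, one_gmul]
  simp [zero_gmul]

/-- The change from coordinate fields to the frame is unitriangular: the e₁, e₂, f₁, f₂ coefficients
are coordinate coefficients, and those at e₃, f₃ are corrected only by the f₁, f₂ ones. -/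
theorem vf_ext {X Y : VF U} (hh : hCoeff U X = hCoeff U Y) (hg : gCoeff U X = gCoeff U Y)
    (h0 : X (Sum.inl 0) = Y (Sum.inl 0)) (h1 : X (Sum.inl 1) = Y (Sum.inl 1))
    (h2 : X (Sum.inr 0) = Y (Sum.inr 0)) (h3 : X (Sum.inr 1) = Y (Sum.inr 1)) : X = Y := by
  rw [hCoeff_apply, hCoeff_apply, h2, h3] at hh
  rw [gCoeff_apply, gCoeff_apply, h2, h3] at hg
  exact funext (forall_idx.2 ⟨h0, h1, sub_left_injective (sub_left_injective hh), h2, h3,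
    sub_left_injective (sub_left_injective hg)⟩)

/-- A submodule spanned by part of a frame is cut out by the remaining coefficients. This makes
membership in the distribution a pair of equations. -/
theorem mem_dist_iff {Y : VF U} : Y ∈ dist U ↔ hCoeff U Y = 0 ∧ gCoeff U Y = 0 := by
  constructor
  · intro hY
    have h : dist U ≤ LinearMap.ker (hCoeff U) ⊓ LinearMap.ker (gCoeff U) := by
      refine Submodule.span_le.2 ?_
      rintro Y ⟨F, Z, hZ, rfl⟩
      rw [SetLike.mem_coe, Submodule.mem_inf, LinearMap.mem_ker, LinearMap.mem_ker, hCoeff_fmul,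
        gCoeff_fmul]
      rcases hZ with rfl | rfl | rfl | rfl <;> simp [hCoeff_frame, gCoeff_frame, gmul_zero]
    exact h hY
  · rintro ⟨hh, hg⟩
    have key : Y = Y (Sum.inl 0) ⊡ e U 0 + Y (Sum.inl 1) ⊡ e U 1 + Y (Sum.inr 0) ⊡ f U 0
        + Y (Sum.inr 1) ⊡ f U 1 := by
      refine vf_ext ?_ ?_ ?_ ?_ ?_ ?_
      · simp only [map_add, hCoeff_fmul, hCoeff_frame, gmul_zero, hh, add_zero]
      · simp only [map_add, gCoeff_fmul, gCoeff_frame, gmul_zero, hg, add_zero]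
      all_goals
        simp [fmul, f_zero_apply, f_one_apply, e, bas_apply, gmul_zero, gmul_one]
    rw [key]
    refine Submodule.add_mem _ (Submodule.add_mem _ (Submodule.add_mem _ ?_ ?_) ?_) ?_ <;>
    exact Submodule.subset_span ⟨_, _, by simp, rfl⟩

theorem fmul_mem_dist (F : SFun U) {Y : VF U} (hY : Y ∈ dist U) : F ⊡ Y ∈ dist U := by
  rw [mem_dist_iff] at *
  rw [hCoeff_fmul, gCoeff_fmul, hY.1, hY.2, gmul_zero]
  exact ⟨rfl, rfl⟩

theorem sfComp_gmul (p q : ZMod 2) (F : SFun U) {G : SFun U} (hG : G ∈ sfParity (holo U) q) :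
    sfComp (p + q) (F ⋄ G) = sfComp p F ⋄ G := by
  have h : ∀ p' : ZMod 2, p' ≠ p → sfComp (p + q) (sfComp p' F ⋄ G) = 0 := fun p' hp =>
    sfComp_of_mem_ne (gmul_mem_sfParity (sfComp_mem p' F) hG) fun h => hp (add_right_cancel h)
  have h' := sfComp_of_mem (gmul_mem_sfParity (sfComp_mem p F) hG)
  conv_lhs => rw [← sfComp_zero_add_one F, add_gmul, map_add]
  rcases zmod_two_cases p with rfl | rfl
  · rw [h', h 1 (by decide), add_zero]
  · rw [h', h 0 (by decide), zero_add]

theorem hCoeff_vfComp (p : ZMod 2) (X : VF U) : hCoeff U (vfComp p X) = sfComp p (hCoeff U X) := by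
  have h : p = (p + 1) + 1 := by rw [add_assoc, one_add_one_zmod, add_zero]
  simp only [hCoeff_apply, vfComp, idxParity, add_zero, map_sub]
  conv_rhs => rw [h, sfComp_gmul _ _ _ (xi_mem_sfParity 1), sfComp_gmul _ _ _ (xi_mem_sfParity 0),
    ← h]

theorem gCoeff_vfComp (p : ZMod 2) (X : VF U) :
    gCoeff U (vfComp p X) = sfComp (p + 1) (gCoeff U X) := by
  have h : p + 1 = (p + 1) + 0 := (add_zero _).symm
  simp only [gCoeff_apply, vfComp, idxParity, map_sub]
  conv_rhs => rw [h, sfComp_gmul _ _ _ (ofFun_mem_sfParity _),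
    sfComp_gmul _ _ _ (ofFun_mem_sfParity _),
    ← h]

theorem vfComp_mem_dist (p : ZMod 2) {Y : VF U} (hY : Y ∈ dist U) : vfComp p Y ∈ dist U := by
  rw [mem_dist_iff] at *
  rw [hCoeff_vfComp, gCoeff_vfComp, hY.1, hY.2, map_zero, map_zero]
  exact ⟨rfl, rfl⟩

theorem hCoeff_mem_sfParity {p : ZMod 2} {X : VF U} (hX : X ∈ vfParity U p) :
    hCoeff U X ∈ sfParity (holo U) p := by
  rw [mem_sfParity_iff, ← hCoeff_vfComp, vfComp_of_mem hX]

theorem gCoeff_mem_sfParity {p : ZMod 2} {X : VF U} (hX : X ∈ vfParity U p) :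
    gCoeff U X ∈ sfParity (holo U) (p + 1) := by
  rw [mem_sfParity_iff, ← gCoeff_vfComp, vfComp_of_mem hX]

/-! ### The symmetry algebra -/

theorem generator_mem_dist {Z : VF U} (hZ : Z ∈ ({e U 0, e U 1, f U 0, f U 1} : Set (VF U))) :
    Z ∈ dist U := by
  rw [mem_dist_iff]
  rcases hZ with rfl | rfl | rfl | rfl <;> simp [hCoeff_frame, gCoeff_frame]

theorem generator_parity {Z : VF U} (hZ : Z ∈ ({e U 0, e U 1, f U 0, f U 1} : Set (VF U))) :
    ∃ r, Z ∈ vfParity U r := by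
  rcases hZ with rfl | rfl | rfl | rfl
  exacts [⟨_, e_mem_vfParity 0⟩, ⟨_, e_mem_vfParity 1⟩,
    ⟨_, f_mem_vfParity 0⟩, ⟨_, f_mem_vfParity 1⟩]

/-- By the Leibniz rule [X, FZ] = X(F) Z ± F [X, Z], and both terms lie in the distribution. The
rule needs F homogeneous, so F is split into its even and odd parts. -/
theorem mem_sym_of_generators {p : ZMod 2} {X : VF U} (hX : X ∈ vfParity U p)
    (h : ∀ Z ∈ ({e U 0, e U 1, f U 0, f U 1} : Set (VF U)), bracket X Z ∈ dist U) : X ∈ sym U := by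
  intro Y hY
  refine Submodule.span_induction ?_ ?_ ?_ ?_ hY
  · rintro Y ⟨F, Z, hZ, rfl⟩
    obtain ⟨r, hr⟩ := generator_parity hZ
    have hom : ∀ q, ∀ F ∈ sfParity (holo U) q, bracket X (F ⊡ Z) ∈ dist U := by
      intro q F hF
      rw [bracket_fmul_right hX hF hr]
      exact Submodule.add_mem _ (fmul_mem_dist _ (generator_mem_dist hZ))
        (Submodule.smul_mem _ _ (fmul_mem_dist _ (h Z hZ)))
    have hadd : F ⊡ Z = sfComp 0 F ⊡ Z + sfComp 1 F ⊡ Z := by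
      funext A
      simp only [fmul, Pi.add_apply, ← add_gmul, sfComp_zero_add_one]
    rw [hadd, bracket_add_right]
    exact Submodule.add_mem _ (hom 0 _ (sfComp_mem 0 F)) (hom 1 _ (sfComp_mem 1 F))
  · rw [bracket_zero_right]
    exact Submodule.zero_mem _
  · intro Y Y' _ _ hY hY'
    rw [bracket_add_right]
    exact Submodule.add_mem _ hY hY'
  · intro c Y _ hY
    rw [bracket_smul_right]
    exact Submodule.smul_mem _ c hY

/-- The generators are homogeneous, so bracketing one of them with a component of X gives a
component of its bracket with X, and the distribution is stable under taking components. -/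
theorem vfComp_mem_sym {X : VF U} (hX : X ∈ sym U) (p : ZMod 2) : vfComp p X ∈ sym U := by
  refine mem_sym_of_generators (vfComp_mem p X) fun Z hZ => ?_
  obtain ⟨r, hr⟩ := generator_parity hZ
  rw [← vfComp_bracket p r X Z hr]
  exact vfComp_mem_dist _ (hX Z (generator_mem_dist hZ))

theorem bracket_eq_sum_vfComp (X Y : VF U) : bracket X Y =
    ∑ p : ZMod 2, ∑ q : ZMod 2, bracket (vfComp p X) (vfComp q Y) := by
  conv_lhs => rw [← vfComp_zero_add_one X, ← vfComp_zero_add_one Y]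
  simp only [sum_zmod_two, bracket_add_left, bracket_add_right]
  abel

theorem bracket_mem_sym {X Y : VF U} (hX : X ∈ sym U) (hY : Y ∈ sym U) : bracket X Y ∈ sym U := by
  rw [bracket_eq_sum_vfComp]
  refine Submodule.sum_mem _ fun p _ => Submodule.sum_mem _ fun q _ => ?_
  have hXp := vfComp_mem p X
  have hYq := vfComp_mem q Y
  refine mem_sym_of_generators (bracket_mem_vfParity hXp hYq) fun Z hZ => ?_
  obtain ⟨r, hr⟩ := generator_parity hZ
  have hZd := generator_mem_dist hZ
  rw [bracket_jacobi hXp hYq hr]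
  exact Submodule.sub_mem _ (vfComp_mem_sym hX p _ (vfComp_mem_sym hY q _ hZd))
    (Submodule.smul_mem _ _ (vfComp_mem_sym hY q _ (vfComp_mem_sym hX p _ hZd)))

/-! ### Determining equations: e₃ and f₃ coefficients of brackets with the generators -/

variable {p : ZMod 2} {X : VF U}

theorem hCoeff_bracket_e (hX : X ∈ vfParity U p) (i : Fin 3) :
    hCoeff U (bracket X (e U i)) = - pd U (Sum.inl i) (hCoeff U X) := by
  simp only [hCoeff_apply, bracket_e p hX, map_sub, pd_inl_gmul, pd_inl_xi, gmul_zero, neg_gmul]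
  abel

/-- The extra terms come from the explicit y₁, y₂ in `gCoeff`; they encode [e₁, f₁] = [e₂, f₂] = f₃.
-/
theorem gCoeff_bracket_e (hX : X ∈ vfParity U p) (i : Fin 3) :
    gCoeff U (bracket X (e U i)) = - (pd U (Sum.inl i) (gCoeff U X)
      + X (Sum.inr 0) ⋄ ofFun (pderiv U i (coordFun U 0))
      + X (Sum.inr 1) ⋄ ofFun (pderiv U i (coordFun U 1))) := by
  simp only [gCoeff_apply, bracket_e p hX, map_sub, pd_inl_gmul, pd_inl_ofFun, neg_gmul]
  abel

theorem act_f_gmul (hX : X ∈ vfParity U p) (i : Fin 3) (A : Fin 3) (G : SFun U) :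
    act (f U i) (X (Sum.inr A) ⋄ G) =
    act (f U i) (X (Sum.inr A)) ⋄ G - koszul p 1 • (X (Sum.inr A) ⋄ act (f U i) G) := by
  rw [act_gmul (f_mem_vfParity i) (hX (Sum.inr A)), idxParity, koszul_add_right, koszul_one_one,
    koszul_comm 1 p, mul_neg_one]
  exact (congrArg _ (neg_smul _ _)).trans (sub_eq_add_neg _ _).symm

/-- The factor 2 is that of [f₁, f₂] = 2e₃: besides the derivative of the e₃ coefficient, only the
f₂ component of X contributes to e₃ in a bracket with f₁. -/
theorem hCoeff_bracket_f_zero (hX : X ∈ vfParity U p) : hCoeff U (bracket X (f U 0)) =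
    (2 : ℂ) • X (Sum.inr 1) - koszul p 1 • act (f U 0) (hCoeff U X) := by
  have h := koszul_mul_self p 1
  simp only [hCoeff_apply, bracket_apply hX (f_mem_vfParity 0), f_zero_apply, act_sub_right,
    act_f_gmul hX, act_xi, act_ofFun_one, act_zero_right, sub_gmul, smul_gmul, zero_gmul, gmul_zero,
    gmul_one]
  match_scalars <;> first | ring1 | linear_combination h

theorem hCoeff_bracket_f_one (hX : X ∈ vfParity U p) : hCoeff U (bracket X (f U 1)) =
    (2 : ℂ) • X (Sum.inr 0) - koszul p 1 • act (f U 1) (hCoeff U X) := by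
  have h := koszul_mul_self p 1
  simp only [hCoeff_apply, bracket_apply hX (f_mem_vfParity 1), f_one_apply, act_sub_right,
    act_f_gmul hX, act_xi, act_ofFun_one, act_zero_right, sub_gmul, smul_gmul, zero_gmul, gmul_zero,
    gmul_one]
  match_scalars <;> first | ring1 | linear_combination h

/-- Here only the e₁ component of X contributes besides the derivative, through [e₁, f₁] = f₃. -/
theorem gCoeff_bracket_f_zero (hX : X ∈ vfParity U p) : gCoeff U (bracket X (f U 0)) =
    X (Sum.inl 0) - koszul p 1 • act (f U 0) (gCoeff U X) := by
  simp only [gCoeff_apply, bracket_apply hX (f_mem_vfParity 0), f_zero_apply, act_sub_right,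
    act_f_gmul hX, act_ofFun_coordFun, act_ofFun_one, act_zero_right, sub_gmul, smul_gmul,
    zero_gmul, gmul_zero]
  match_scalars <;> ring

theorem gCoeff_bracket_f_one (hX : X ∈ vfParity U p) : gCoeff U (bracket X (f U 1)) =
    X (Sum.inl 1) - koszul p 1 • act (f U 1) (gCoeff U X) := by
  simp only [gCoeff_apply, bracket_apply hX (f_mem_vfParity 1), f_one_apply, act_sub_right,
    act_f_gmul hX, act_ofFun_coordFun, act_ofFun_one, act_zero_right, sub_gmul, smul_gmul,
    zero_gmul, gmul_zero]
  match_scalars <;> ring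

/-- The determining equations of a homogeneous symmetry. -/
theorem mem_sym_iff (hX : X ∈ vfParity U p) : X ∈ sym U ↔
    (pd U (Sum.inl 0) (hCoeff U X) = 0 ∧ pd U (Sum.inl 1) (hCoeff U X) = 0) ∧
    (pd U (Sum.inl 0) (gCoeff U X) = -X (Sum.inr 0) ∧
      pd U (Sum.inl 1) (gCoeff U X) = -X (Sum.inr 1)) ∧
    ((2 : ℂ) • X (Sum.inr 0) = koszul p 1 • act (f U 1) (hCoeff U X) ∧
      (2 : ℂ) • X (Sum.inr 1) = koszul p 1 • act (f U 0) (hCoeff U X)) ∧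
    (X (Sum.inl 0) = koszul p 1 • act (f U 0) (gCoeff U X) ∧
      X (Sum.inl 1) = koszul p 1 • act (f U 1) (gCoeff U X)) := by
  have h : X ∈ sym U ↔ bracket X (e U 0) ∈ dist U ∧ bracket X (e U 1) ∈ dist U ∧
      bracket X (f U 0) ∈ dist U ∧ bracket X (f U 1) ∈ dist U := by
    constructor
    · intro h
      refine ⟨?_, ?_, ?_, ?_⟩ <;> exact h _ (generator_mem_dist (by simp))
    · rintro ⟨h0, h1, h2, h3⟩
      refine mem_sym_of_generators hX ?_
      rintro Z (rfl | rfl | rfl | rfl)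
      exacts [h0, h1, h2, h3]
  rw [h]
  simp only [mem_dist_iff, hCoeff_bracket_e hX, gCoeff_bracket_e hX, hCoeff_bracket_f_zero hX,
    hCoeff_bracket_f_one hX, gCoeff_bracket_f_zero hX, gCoeff_bracket_f_one hX, sub_eq_zero,
    neg_eq_zero, pderiv_coordFun]
  simp only [if_true, show ¬ ((0 : Fin 3) = 1) by decide, show ¬ ((1 : Fin 3) = 0) by decide,
    if_false, ofFun_zero, gmul_zero, gmul_one, add_zero, ← eq_neg_iff_add_eq_zero]
  constructor
  · rintro ⟨⟨a1, b1⟩, ⟨a2, b2⟩, ⟨a3, b3⟩, a4, b4⟩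
    exact ⟨⟨a1, a2⟩, ⟨b1, b2⟩, ⟨a4, a3⟩, b3, b4⟩
  · rintro ⟨⟨a1, a2⟩, ⟨b1, b2⟩, ⟨a4, a3⟩, b3, b4⟩
    exact ⟨⟨a1, b1⟩, ⟨a2, b2⟩, ⟨a3, b3⟩, a4, b4⟩

end

/-! ### Functions of `y₃` -/

section
variable {U : Opens (Fin 3 → ℂ)}

theorem pull_apply (φ : holo (proj3 U)) (x : U) :
    (pull U φ).1 x = φ.1 ⟨x.1 2, x.1, x.2, rfl⟩ := rfl

theorem pull_injective : Function.Injective (pull U) := by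
  intro φ ψ h
  ext ⟨t, y, hy, ht⟩
  subst ht
  exact congrFun (congrArg Subtype.val h) ⟨y, hy⟩

theorem zeroExt_pull_eventuallyEq (φ : holo (proj3 U)) (x : U) :
    zeroExt U (pull U φ).1 =ᶠ[nhds x.1] fun z => zeroExt (proj3 U) φ.1 (z 2) := by
  filter_upwards [U.2.mem_nhds x.2] with z hz
  rw [zeroExt_of_mem U _ hz, zeroExt_of_mem (proj3 U) _ ⟨z, hz, rfl⟩]
  rfl

theorem pderiv_pull (i : Fin 3) (φ : holo (proj3 U)) (x : U) : (pderiv U i (pull U φ)).1 x =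
    (Pi.single i 1 : Fin 3 → ℂ) 2 * deriv (zeroExt (proj3 U) φ.1) (x.1 2) := by
  have h2 : HasFDerivAt (fun z : Fin 3 → ℂ => z 2)
      (ContinuousLinearMap.proj (R := ℂ) (φ := fun _ : Fin 3 => ℂ) 2) x.1 :=
    (ContinuousLinearMap.proj (R := ℂ) (φ := fun _ : Fin 3 => ℂ) 2).hasFDerivAt
  have hφ := (φ.2 (x.1 2) ⟨x.1, x.2, rfl⟩).differentiableAt.hasDerivAt
  have h3 := hφ.comp_hasFDerivAt x.1 h2
  rw [pderiv_apply, ((zeroExt_pull_eventuallyEq φ x).hasFDerivAt_iff.2 h3).fderiv]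
  simp [mul_comm]

theorem pderiv_pull_of_ne {i : Fin 3} (hi : i ≠ 2) (φ : holo (proj3 U)) :
    pderiv U i (pull U φ) = 0 := by
  ext x
  refine (pderiv_pull i φ x).trans ?_
  rw [Pi.single_eq_of_ne hi.symm, zero_mul]
  rfl

/-- A fibre of y₃ is an open connected subset of ℂ², through the embedding `j`, and on it the
function has zero derivative. -/
theorem eq_of_pderiv_eq_zero (hfib : ∀ t : ℂ, IsPreconnected {y : Fin 3 → ℂ | y ∈ U ∧ y 2 = t})
    {F : holo U} (h0 : pderiv U 0 F = 0) (h1 : pderiv U 1 F = 0) {x y : Fin 3 → ℂ}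
    (hx : x ∈ U) (hy : y ∈ U) (hxy : x 2 = y 2) : zeroExt U F.1 x = zeroExt U F.1 y := by
  set j : ℂ × ℂ → Fin 3 → ℂ := fun w => ![w.1, w.2, x 2] with hj
  set L : ℂ × ℂ →L[ℂ] Fin 3 → ℂ := ContinuousLinearMap.pi
    ![ContinuousLinearMap.fst ℂ ℂ ℂ, ContinuousLinearMap.snd ℂ ℂ ℂ, 0] with hL
  have hjL : ∀ w, HasFDerivAt j L w := by
    intro w
    have hjw : j = fun w => L w + Pi.single 2 (x 2) := by
      funext w i
      fin_cases i <;> simp [hj, hL]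
    rw [hjw]
    exact L.hasFDerivAt.add_const _
  have hjc : Continuous j := continuous_iff_continuousAt.2 fun w => (hjL w).continuousAt
  have hjmk : ∀ z : Fin 3 → ℂ, z 2 = x 2 → j (z 0, z 1) = z := by
    intro z hz
    funext i
    fin_cases i <;> simp [hj, hz]
  have hopen : IsOpen (j ⁻¹' U) := U.2.preimage hjc
  -- As a preimage under `j` the slice is open; as an image of the fibre it is connected.
  have himg : j ⁻¹' U = (fun z : Fin 3 → ℂ => (z 0, z 1)) '' {y | y ∈ U ∧ y 2 = x 2} := by
    ext w
    constructor
    · intro hw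
      exact ⟨j w, ⟨hw, rfl⟩, rfl⟩
    · rintro ⟨z, ⟨hz, hz2⟩, rfl⟩
      change j (z 0, z 1) ∈ U
      rwa [hjmk z hz2]
  have hconn : IsPreconnected (j ⁻¹' U) := by
    rw [himg]
    exact (hfib (x 2)).image _ (by fun_prop)
  have hder : ∀ w ∈ j ⁻¹' (U : Set (Fin 3 → ℂ)), 
      HasFDerivAt (zeroExt U F.1 ∘ j) (0 : ℂ × ℂ →L[ℂ] ℂ) w := by
    intro w hw
    have h := (F.2 (j w) hw).differentiableAt.hasFDerivAt.comp w (hjL w)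
    refine h.congr_fderiv ?_
    ext
    · have h0' : (pderiv U 0 F).1 ⟨j w, hw⟩ = 0 := by rw [h0]; rfl
      rw [pderiv_apply] at h0'
      have : L (1, 0) = Pi.single 0 1 := by
        funext i
        fin_cases i <;> simp [hL]
      simp [this, h0']
    · have h1' : (pderiv U 1 F).1 ⟨j w, hw⟩ = 0 := by rw [h1]; rfl
      rw [pderiv_apply] at h1'
      have : L (0, 1) = Pi.single 1 1 := by
        funext i
        fin_cases i <;> simp [hL]
      simp [this, h1']
  have hfin := hopen.is_const_of_fderiv_eq_zero (𝕜 := ℂ) hconn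
    (fun w hw => (hder w hw).differentiableAt.differentiableWithinAt)
    (fun w hw => (hder w hw).fderiv)
    (x := (x 0, x 1)) (y := (y 0, y 1)) (by rw [himg]; exact ⟨x, ⟨hx, rfl⟩, rfl⟩)
    (by rw [himg]; exact ⟨y, ⟨hy, hxy.symm⟩, rfl⟩)
  simpa [hjmk x rfl, hjmk y hxy.symm] using hfin

/-- A holomorphic function that does not depend on `y₁`, `y₂` is a function of `y₃` if the fibres of
`y₃` are connected. -/
theorem exists_pull_eq (hfib : ∀ t : ℂ, IsPreconnected {y : Fin 3 → ℂ | y ∈ U ∧ y 2 = t})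
    {F : holo U} (h0 : pderiv U 0 F = 0) (h1 : pderiv U 1 F = 0) :
    ∃ φ : holo (proj3 U), pull U φ = F := by
  -- The function of y₃ is defined by evaluating F at a chosen point of each fibre; the value does
  -- not depend on the choice.
  have hval : ∀ (t : proj3 U) (x : Fin 3 → ℂ), x ∈ U → x 2 = t →
      zeroExt U F.1 (Classical.choose t.2) = zeroExt U F.1 x := by
    intro t x hx hxt
    have ht := Classical.choose_spec t.2
    exact eq_of_pderiv_eq_zero hfib h0 h1 ht.1 hx (ht.2.trans hxt.symm)
  refine ⟨⟨fun t => zeroExt U F.1 (Classical.choose t.2), ?_⟩, ?_⟩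
  · rintro t ⟨x, hx, rfl⟩
    -- The chosen points need not vary analytically with t. Near a given value they are replaced by
    -- the local section of y₃ that moves only the third coordinate of x.
    have hup : AnalyticAt ℂ (fun s : ℂ => x + (s - x 2) • (Pi.single 2 1 : Fin 3 → ℂ)) (x 2) := by
      fun_prop
    have hx' : x + (x 2 - x 2) • (Pi.single 2 1 : Fin 3 → ℂ) = x := by simp
    have hF : AnalyticAt ℂ (zeroExt U F.1) (x + (x 2 - x 2) • (Pi.single 2 1 : Fin 3 → ℂ)) := by
      rw [hx']; exact F.2 x hx
    refine (hF.fun_comp (f := fun s : ℂ => x + (s - x 2) • (Pi.single 2 1 : Fin 3 → ℂ))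
      hup).congr ?_
    have hmem : ∀ᶠ s in nhds (x 2), x + (s - x 2) • (Pi.single 2 1 : Fin 3 → ℂ) ∈ U :=
      hup.continuousAt.preimage_mem_nhds (U.2.mem_nhds (by rw [hx']; exact hx))
    filter_upwards [hmem] with s hs
    have hs2 : (x + (s - x 2) • (Pi.single 2 1 : Fin 3 → ℂ)) 2 = s := by simp
    have hsm : s ∈ proj3 U := ⟨_, hs, hs2⟩
    rw [zeroExt_of_mem (proj3 U) _ hsm]
    exact (hval ⟨s, hsm⟩ _ hs hs2).symm
  · ext x
    refine (hval ⟨x.1 2, x.1, x.2, rfl⟩ x.1 x.2 rfl).trans ?_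
    exact zeroExt_of_mem U _ x.2

theorem lift_injective : Function.Injective (lift U) := by
  intro h h' hh
  funext S
  exact pull_injective (congrFun hh S)

theorem lift_add (h h' : SFun3 U) : lift U (h + h') = lift U h + lift U h' := rfl

theorem lift_smul (c : ℂ) (h : SFun3 U) : lift U (c • h) = c • lift U h := rfl

theorem lift_mem_sfParity_iff {p : ZMod 2} {h : SFun3 U} :
    lift U h ∈ sfParity (holo U) p ↔ h ∈ sfParity (holo (proj3 U)) p := by
  have h0 : ∀ φ : holo (proj3 U), pull U φ = 0 ↔ φ = 0 := fun φ =>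
    pull_injective.eq_iff (b := 0)
  constructor
  · intro H S hS
    exact (h0 _).1 (H S hS)
  · intro H S hS
    exact (h0 _).2 (H S hS)

theorem pd_lift_of_ne {i : Fin 3} (hi : i ≠ 2) (h : SFun3 U) : pd U (Sum.inl i) (lift U h) = 0 := by
  funext S
  exact pderiv_pull_of_ne hi (h S)

theorem exists_lift_eq (hfib : ∀ t : ℂ, IsPreconnected {y : Fin 3 → ℂ | y ∈ U ∧ y 2 = t})
    {F : SFun U} (h0 : pd U (Sum.inl 0) F = 0) (h1 : pd U (Sum.inl 1) F = 0) :
    ∃ h : SFun3 U, lift U h = F := by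
  choose h hh using fun S => exists_pull_eq hfib (congrFun h0 S) (congrFun h1 S)
  exact ⟨h, funext hh⟩

/-! ### The general symmetry -/

/-- The difference `g̃ - g` for the function `H = h` of parity `p`. -/
def gShift (U : Opens (Fin 3 → ℂ)) (p : ZMod 2) (H : SFun U) : SFun U :=
  (koszul p 1 / 2) • (act (f U 1) H ⋄ ofFun (coordFun U 0) + act (f U 0) H ⋄ ofFun (coordFun U 1)
    - ofFun (coordFun U 0) ⋄ ofFun (coordFun U 1) ⋄ dxi 2 H)

theorem neg_one_pow_val (p : ZMod 2) : (-1 : ℂ) ^ p.val = koszul p 1 := by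
  simp [koszul, show (1 : ZMod 2).val = 1 from rfl]

theorem neg_one_pow_val_add_one (p : ZMod 2) : -(-1 : ℂ) ^ (p + 1).val = koszul p 1 := by
  rw [neg_one_pow_val, koszul_add_left, koszul_one_one, mul_neg_one, neg_neg]

theorem gTilde_eq (p : ZMod 2) (h g : SFun3 U) :
    gTilde U p h g = lift U g - gShift U p (lift U h) := by
  rw [gTilde, gShift, neg_one_pow_val, one_div_mul_eq_div]
  rfl

theorem symField_eq (p : ZMod 2) (h g : SFun3 U) : symField U p h g =
    (koszul p 1 / 2) • (act (f U 1) (lift U h) ⊡ f U 0 + act (f U 0) (lift U h) ⊡ f U 1)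
    + lift U h ⊡ e U 2 + gTilde U p h g ⊡ f U 2
    + (koszul p 1 • act (f U 0) (gTilde U p h g)) ⊡ e U 0
    + (koszul p 1 • act (f U 1) (gTilde U p h g)) ⊡ e U 1 := by
  rw [symField, neg_one_pow_val, neg_one_pow_val_add_one, one_div_mul_eq_div]

theorem hCoeff_symField (p : ZMod 2) (h g : SFun3 U) :
    hCoeff U (symField U p h g) = lift U h := by
  rw [symField_eq]
  simp only [map_add, map_smul, hCoeff_fmul, hCoeff_frame, gmul_zero, gmul_one, add_zero, smul_zero,
    zero_add]

theorem gCoeff_symField (p : ZMod 2) (h g : SFun3 U) :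
    gCoeff U (symField U p h g) = gTilde U p h g := by
  rw [symField_eq]
  simp only [map_add, map_smul, gCoeff_fmul, gCoeff_frame, gmul_zero, gmul_one, add_zero, smul_zero,
    zero_add]

theorem symField_apply (p : ZMod 2) (h g : SFun3 U) :
    symField U p h g (Sum.inl 0) = koszul p 1 • act (f U 0) (gTilde U p h g) ∧
    symField U p h g (Sum.inl 1) = koszul p 1 • act (f U 1) (gTilde U p h g) ∧
    symField U p h g (Sum.inr 0) = (koszul p 1 / 2) • act (f U 1) (lift U h) ∧
    symField U p h g (Sum.inr 1) = (koszul p 1 / 2) • act (f U 0) (lift U h) := by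
  rw [symField_eq]
  simp [fmul, f_zero_apply, f_one_apply, f_two_apply, e, bas_apply, gmul_zero, gmul_one]

theorem mem_vfParity_of_frame {p : ZMod 2} {X : VF U} (h : hCoeff U X ∈ sfParity (holo U) p)
    (g : gCoeff U X ∈ sfParity (holo U) (p + 1)) (h0 : X (Sum.inl 0) ∈ sfParity (holo U) p)
    (h1 : X (Sum.inl 1) ∈ sfParity (holo U) p) (h2 : X (Sum.inr 0) ∈ sfParity (holo U) (p + 1))
    (h3 : X (Sum.inr 1) ∈ sfParity (holo U) (p + 1)) : X ∈ vfParity U p := by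
  have hX : vfComp p X = X := by
    refine vf_ext ?_ ?_ ?_ ?_ ?_ ?_
    · rw [hCoeff_vfComp, sfComp_of_mem h]
    · rw [gCoeff_vfComp, sfComp_of_mem g]
    · exact sfComp_of_mem (by rwa [idxParity, add_zero])
    · exact sfComp_of_mem (by rwa [idxParity, add_zero])
    · exact sfComp_of_mem h2
    · exact sfComp_of_mem h3
  rw [← hX]
  exact vfComp_mem p X

theorem act_f_mem_sfParity {p : ZMod 2} (i : Fin 3) {F : SFun U} (hF : F ∈ sfParity (holo U) p) :
    act (f U i) F ∈ sfParity (holo U) (p + 1) := by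
  rw [add_comm]
  exact act_mem_sfParity (f_mem_vfParity i) hF

theorem gShift_mem_sfParity {p : ZMod 2} {H : SFun U} (hH : H ∈ sfParity (holo U) p) :
    gShift U p H ∈ sfParity (holo U) (p + 1) := by
  have hmul : ∀ {q : ZMod 2} {F : SFun U} (i : Fin 3), F ∈ sfParity (holo U) q →
      F ⋄ ofFun (coordFun U i) ∈ sfParity (holo U) q := by
    intro q F i hF
    have h := gmul_mem_sfParity hF (ofFun_mem_sfParity (coordFun U i))
    rwa [add_zero] at h
  refine Submodule.smul_mem _ _ (Submodule.sub_mem _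
    (Submodule.add_mem _ (hmul 0 ?_) (hmul 1 ?_)) ?_)
  · exact act_f_mem_sfParity 1 hH
  · exact act_f_mem_sfParity 0 hH
  · have h := gmul_mem_sfParity (gmul_mem_sfParity (ofFun_mem_sfParity (coordFun U 0))
      (ofFun_mem_sfParity (coordFun U 1))) (dxi_mem_sfParity 2 hH)
    rwa [add_zero, zero_add] at h

theorem gTilde_mem_sfParity {p : ZMod 2} {h g : SFun3 U}
    (hh : h ∈ sfParity (holo (proj3 U)) p) (hg : g ∈ sfParity (holo (proj3 U)) (p + 1)) :
    gTilde U p h g ∈ sfParity (holo U) (p + 1) := by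
  rw [gTilde_eq]
  exact Submodule.sub_mem _ (lift_mem_sfParity_iff.2 hg)
    (gShift_mem_sfParity (lift_mem_sfParity_iff.2 hh))

theorem symField_mem_vfParity {p : ZMod 2} {h g : SFun3 U}
    (hh : h ∈ sfParity (holo (proj3 U)) p) (hg : g ∈ sfParity (holo (proj3 U)) (p + 1)) :
    symField U p h g ∈ vfParity U p := by
  have hH := lift_mem_sfParity_iff.2 hh
  have hG := gTilde_mem_sfParity hh hg
  have hp : p + 1 + 1 = p := by rw [add_assoc, one_add_one_zmod, add_zero]
  have ha : ∀ i, act (f U i) (gTilde U p h g) ∈ sfParity (holo U) p := fun i => by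
    have := act_f_mem_sfParity i hG
    rwa [hp] at this
  apply mem_vfParity_of_frame
  · rwa [hCoeff_symField]
  · rwa [gCoeff_symField]
  · rw [(symField_apply p h g).1]; exact Submodule.smul_mem _ _ (ha 0)
  · rw [(symField_apply p h g).2.1]; exact Submodule.smul_mem _ _ (ha 1)
  · rw [(symField_apply p h g).2.2.1]; exact Submodule.smul_mem _ _ (act_f_mem_sfParity 1 hH)
  · rw [(symField_apply p h g).2.2.2]; exact Submodule.smul_mem _ _ (act_f_mem_sfParity 0 hH)

/-- The determining equations for `g̃` are solved by `gShift`. -/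
theorem pd_gShift {p : ZMod 2} {H : SFun U} (h0 : pd U (Sum.inl 0) H = 0)
    (h1 : pd U (Sum.inl 1) H = 0) :
    pd U (Sum.inl 0) (gShift U p H) = (koszul p 1 / 2) • act (f U 1) H ∧
    pd U (Sum.inl 1) (gShift U p H) = (koszul p 1 / 2) • act (f U 0) H := by
  have hcomm : ∀ (i : Fin 3) (B : Idx), pd U (Sum.inl i) H = 0 →
      pd U (Sum.inl i) (pd U B H) = 0 := by
    intro i B hi
    rw [pd_pd, hi, map_zero, smul_zero]
  have hc2 : ∀ i, i ≠ 2 → pd U (Sum.inl i) H = 0 → ∀ j, pd U (Sum.inl i) (dxi j H) = 0 :=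
    fun i _ hi j => hcomm i (Sum.inr j) hi
  simp only [gShift, act_f_zero, act_f_one, map_smul, map_sub, map_add, pd_inl_gmul, pd_inl_ofFun,
    pd_inl_xi, pderiv_coordFun, hcomm 0 (Sum.inl 2) h0, hcomm 1 (Sum.inl 2) h1,
    hc2 0 (by decide) h0, hc2 1 (by decide) h1, gmul_zero, zero_gmul, add_zero, zero_add]
  simp only [if_true, show ¬ ((0 : Fin 3) = 1) by decide, show ¬ ((1 : Fin 3) = 0) by decide,
    if_false, ofFun_zero, gmul_zero, gmul_one, one_gmul, zero_gmul, add_zero, zero_add,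
    ofFun_gmul_comm (dxi 2 H)]
  -- ∂/∂y₁ also hits f₁(H), through its term y₁ ∂_{ξ₃}H, and symmetrically for y₂. The y₁y₂ term in
  -- `gShift` cancels exactly this.
  constructor <;> congr 1 <;> abel

theorem symField_mem_sym {p : ZMod 2} {h g : SFun3 U}
    (hh : h ∈ sfParity (holo (proj3 U)) p) (hg : g ∈ sfParity (holo (proj3 U)) (p + 1)) :
    symField U p h g ∈ sym U := by
  have hs := pd_gShift (p := p) (pd_lift_of_ne (show (0 : Fin 3) ≠ 2 by decide) h)
    (pd_lift_of_ne (show (1 : Fin 3) ≠ 2 by decide) h)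
  obtain ⟨s0, s1, s2, s3⟩ := symField_apply p h g
  rw [mem_sym_iff (symField_mem_vfParity hh hg), hCoeff_symField, gCoeff_symField, s0, s1, s2, s3]
  refine ⟨⟨pd_lift_of_ne (by decide) h, pd_lift_of_ne (by decide) h⟩, ⟨?_, ?_⟩, ⟨?_, ?_⟩, rfl, rfl⟩
  · rw [gTilde_eq, map_sub, hs.1, pd_lift_of_ne (by decide), zero_sub]
  · rw [gTilde_eq, map_sub, hs.2, pd_lift_of_ne (by decide), zero_sub]
  · rw [smul_smul, mul_div_cancel₀ _ (two_ne_zero)]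
  · rw [smul_smul, mul_div_cancel₀ _ (two_ne_zero)]

theorem symField_injective {p : ZMod 2} {h g h' g' : SFun3 U}
    (hX : symField U p h g = symField U p h' g') : h = h' ∧ g = g' := by
  have h1 : h = h' := by
    apply lift_injective
    rw [← hCoeff_symField p h g, hX, hCoeff_symField]
  refine ⟨h1, lift_injective ?_⟩
  have h2 : gTilde U p h g = gTilde U p h' g' := by
    rw [← gCoeff_symField p h g, hX, gCoeff_symField]
  rw [gTilde_eq, gTilde_eq, h1] at h2
  exact sub_left_injective h2

/-- The e₃ coefficient supplies h, the f₃ coefficient supplies g after the shift is undone, and the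
remaining determining equations say that all other coefficients agree. -/
theorem exists_symField_eq (hfib : ∀ t : ℂ, IsPreconnected {y : Fin 3 → ℂ | y ∈ U ∧ y 2 = t})
    {p : ZMod 2} {X : VF U} (hX : X ∈ vfParity U p) (hs : X ∈ sym U) :
    ∃ h ∈ sfParity (holo (proj3 U)) p, ∃ g ∈ sfParity (holo (proj3 U)) (p + 1),
      symField U p h g = X := by
  obtain ⟨⟨a0, a1⟩, ⟨b0, b1⟩, ⟨c0, c1⟩, d0, d1⟩ := (mem_sym_iff hX).1 hs
  obtain ⟨h, hh⟩ := exists_lift_eq hfib a0 a1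
  have half : ∀ {F G : SFun U}, (2 : ℂ) • F = koszul p 1 • G → F = (koszul p 1 / 2) • G := by
    intro F G hFG
    rw [div_eq_inv_mul, mul_smul, ← hFG, smul_smul, inv_mul_cancel₀ two_ne_zero, one_smul]
  have c0' := half c0
  have c1' := half c1
  obtain ⟨s0, s1⟩ := pd_gShift (p := p) a0 a1
  -- The y₁ and y₂ derivatives of the f₃ coefficient and of the shift are opposite, so their sum is
  -- a function of y₃ and ξ only.
  obtain ⟨g, hg⟩ := exists_lift_eq hfib (F := gCoeff U X + gShift U p (hCoeff U X))
    (by rw [map_add, b0, s0, c0', neg_add_cancel]) (by rw [map_add, b1, s1, c1', neg_add_cancel])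
  have hgt : gTilde U p h g = gCoeff U X := by rw [gTilde_eq, hg, hh, add_sub_cancel_right]
  have hpar := hCoeff_mem_sfParity hX
  refine ⟨h, lift_mem_sfParity_iff.1 (hh ▸ hpar), g, lift_mem_sfParity_iff.1 ?_, ?_⟩
  · rw [hg]
    exact Submodule.add_mem _ (gCoeff_mem_sfParity hX) (gShift_mem_sfParity hpar)
  · obtain ⟨t0, t1, t2, t3⟩ := symField_apply p h g
    refine vf_ext ?_ ?_ ?_ ?_ ?_ ?_
    · rw [hCoeff_symField, hh]
    · rw [gCoeff_symField, hgt]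
    · rw [t0, hgt, d0]
    · rw [t1, hgt, d1]
    · rw [t2, hh, c0']
    · rw [t3, hh, c1']

theorem bijOn_symField (hfib : ∀ t : ℂ, IsPreconnected {y : Fin 3 → ℂ | y ∈ U ∧ y 2 = t})
    (p : ZMod 2) : Set.BijOn (fun hg : SFun3 U × SFun3 U => symField U p hg.1 hg.2)
      {hg | hg.1 ∈ sfParity (holo (proj3 U)) p ∧ hg.2 ∈ sfParity (holo (proj3 U)) (p + 1)}
      {X | X ∈ sym U ∧ X ∈ vfParity U p} := by
  refine ⟨?_, ?_, ?_⟩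
  · rintro ⟨h, g⟩ ⟨hh, hg⟩
    exact ⟨symField_mem_sym hh hg, symField_mem_vfParity hh hg⟩
  · rintro ⟨h, g⟩ _ ⟨h', g'⟩ _ hX
    obtain ⟨rfl, rfl⟩ := symField_injective hX
    rfl
  · rintro X ⟨hs, hX⟩
    obtain ⟨h, hh, g, hg, rfl⟩ := exists_symField_eq hfib hX hs
    exact ⟨(h, g), ⟨hh, hg⟩, rfl⟩

end

/-! ### The grading by weight -/

section
variable {U : Opens (Fin 3 → ℂ)}

theorem coord_mem_sfParity (A : Idx) : coord U A ∈ sfParity (holo U) (idxParity A) := by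
  rcases A with i | i
  · exact ofFun_mem_sfParity _
  · exact xi_mem_sfParity i

theorem euler_mem_vfParity : euler U ∈ vfParity U 0 := by
  intro A
  rw [zero_add]
  exact Submodule.smul_mem _ _ (coord_mem_sfParity A)

theorem pd_coord (A B : Idx) : pd U A (coord U B) = if A = B then ofFun 1 else 0 := by
  rcases A with i | i <;> rcases B with j | j
  · simp only [coord, pd_inl_ofFun, pderiv_coordFun, Sum.inl.injEq]
    split_ifs
    · rfl
    · exact ofFun_zero
  · simp [coord, pd_inl_xi]
  · simp [coord, pd_inr, dxi_ofFun]
  · simp [coord, pd_inr, dxi_xi]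

theorem bracket_euler_bas (A : Idx) :
    bracket (euler U) (bas U A) = (-(idxWeight A : ℂ)) • bas U A := by
  funext B
  rw [bracket_apply euler_mem_vfParity (bas_mem_vfParity A), act_bas_apply, koszul_zero_left,
    one_smul, zero_sub, act_bas, euler, map_smul, pd_coord, Pi.smul_apply, bas_apply]
  by_cases h : A = B
  · rw [if_pos h, if_pos h.symm, h]
    exact (neg_smul _ _).symm
  · simp [h, Ne.symm h]

theorem mem_sfWeight {d : ℤ} {F : SFun U} :
    F ∈ sfWeight U d ↔ act (euler U) F = (d : ℂ) • F := Iff.rfl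

theorem sfComp_act_euler (p : ZMod 2) (F : SFun U) :
    sfComp p (act (euler U) F) = act (euler U) (sfComp p F) := by
  have hmem : ∀ q, act (euler U) (sfComp q F) ∈ sfParity (holo U) q := fun q => by
    have h := act_mem_sfParity euler_mem_vfParity (sfComp_mem q F)
    rwa [zero_add] at h
  conv_lhs => rw [← sfComp_zero_add_one F, act_add_right, map_add]
  rcases zmod_two_cases p with rfl | rfl
  · rw [sfComp_of_mem (hmem 0), sfComp_of_mem_ne (hmem 1) (by decide), add_zero]
  · rw [sfComp_of_mem (hmem 1), sfComp_of_mem_ne (hmem 0) (by decide), zero_add]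

theorem sfComp_mem_sfWeight {d : ℤ} {F : SFun U} (hF : F ∈ sfWeight U d) (p : ZMod 2) :
    sfComp p F ∈ sfWeight U d := by
  rw [mem_sfWeight] at *
  rw [← sfComp_act_euler, hF, map_smul]

theorem act_euler_gmul (F G : SFun U) :
    act (euler U) (F ⋄ G) = act (euler U) F ⋄ G + F ⋄ act (euler U) G := by
  have h : ∀ p, act (euler U) (sfComp p F ⋄ G) =
      act (euler U) (sfComp p F) ⋄ G + sfComp p F ⋄ act (euler U) G := fun p => by
    rw [act_gmul euler_mem_vfParity (sfComp_mem p F), koszul_zero_left, one_smul]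
  conv_lhs => rw [← sfComp_zero_add_one F, add_gmul, act_add_right, h, h]
  conv_rhs => rw [← sfComp_zero_add_one F, add_gmul, act_add_right, add_gmul]
  abel

theorem gmul_mem_sfWeight {c d : ℤ} {F G : SFun U} (hF : F ∈ sfWeight U c)
    (hG : G ∈ sfWeight U d) : F ⋄ G ∈ sfWeight U (c + d) := by
  rw [mem_sfWeight] at *
  rw [act_euler_gmul, hF, hG, smul_gmul, gmul_smul, ← add_smul, Int.cast_add]

/-- For the Euler field E, [E, ∂_A] = -w(A) ∂_A, so ∂_A shifts eigenvalues of E by -w(A). -/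
theorem pd_mem_sfWeight {d : ℤ} {F : SFun U} (hF : F ∈ sfWeight U d) (A : Idx) :
    pd U A F ∈ sfWeight U (d - idxWeight A) := by
  rw [mem_sfWeight] at *
  have h := act_bracket euler_mem_vfParity (bas_mem_vfParity A) F
  rw [bracket_euler_bas, koszul_zero_left, one_smul, act_bas, act_bas, hF, map_smul,
    act_smul_left, act_bas] at h
  rw [eq_sub_iff_add_eq] at h
  rw [← h, ← add_smul]
  congr 1
  push_cast
  ring

theorem act_mem_sfWeight {k d : ℤ} {X : VF U} {F : SFun U} (hX : X ∈ vfWeight U k)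
    (hF : F ∈ sfWeight U d) : act X F ∈ sfWeight U (k + d) := by
  refine Submodule.sum_mem _ fun A _ => ?_
  have h := gmul_mem_sfWeight (hX A) (pd_mem_sfWeight hF A)
  rwa [show k + idxWeight A + (d - idxWeight A) = k + d by ring] at h

theorem vfComp_mem_vfWeight {k : ℤ} {X : VF U} (hX : X ∈ vfWeight U k) (p : ZMod 2) :
    vfComp p X ∈ vfWeight U k :=
  fun A => sfComp_mem_sfWeight (hX A) _

theorem bracket_mem_vfWeight {k l : ℤ} {X Y : VF U} (hX : X ∈ vfWeight U k)
    (hY : Y ∈ vfWeight U l) : bracket X Y ∈ vfWeight U (k + l) := by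
  intro A
  refine Submodule.sum_mem _ fun p _ => Submodule.sum_mem _ fun q _ => ?_
  refine Submodule.sub_mem _ ?_ (Submodule.smul_mem _ _ ?_)
  · rw [add_assoc]
    exact act_mem_sfWeight (vfComp_mem_vfWeight hX p) (vfComp_mem_vfWeight hY q A)
  · rw [add_comm k, add_assoc]
    exact act_mem_sfWeight (vfComp_mem_vfWeight hY q) (vfComp_mem_vfWeight hX p A)

theorem bracket_mem_symWeight {k l : ℤ} {X Y : VF U} (hX : X ∈ symWeight U k)
    (hY : Y ∈ symWeight U l) : bracket X Y ∈ symWeight U (k + l) :=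
  ⟨bracket_mem_sym hX.1 hY.1, bracket_mem_vfWeight hX.2 hY.2⟩

/-- The operator `[E, ·]` for the Euler field `E`. -/
def eulerOp (U : Opens (Fin 3 → ℂ)) : Module.End ℂ (VF U) where
  toFun X A := act (euler U) (X A) - (idxWeight A : ℂ) • X A
  map_add' X Y := by
    funext A
    simp only [Pi.add_apply, act_add_right, smul_add]
    abel
  map_smul' c X := by
    funext A
    simp only [Pi.smul_apply, act_smul_right, smul_sub, RingHom.id_apply]
    rw [smul_comm c]

theorem vfWeight_le_eigenspace (k : ℤ) :
    vfWeight U k ≤ (eulerOp U).eigenspace (k : ℂ) := by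
  intro X hX
  rw [Module.End.mem_eigenspace_iff]
  funext A
  have h := mem_sfWeight.1 (hX A)
  change act (euler U) (X A) - (idxWeight A : ℂ) • X A = (k : ℂ) • X A
  rw [h, sub_eq_iff_eq_add, ← add_smul, Int.cast_add]

/-- The weight spaces sit in eigenspaces of one operator, `eulerOp`, with distinct eigenvalues. -/
theorem iSupIndep_symWeight : iSupIndep (symWeight U) := by
  have h := ((eulerOp U).eigenspaces_iSupIndep).comp (f := fun k : ℤ => (k : ℂ)) Int.cast_injective
  exact h.mono fun k => le_trans inf_le_right (vfWeight_le_eigenspace k)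

/-! ### Weights of the general symmetry -/

theorem ofFun_one_mem_sfWeight : (ofFun 1 : SFun U) ∈ sfWeight U 0 := by
  rw [mem_sfWeight, act_ofFun_one]
  simp

theorem coord_mem_sfWeight (A : Idx) : coord U A ∈ sfWeight U (idxWeight A) := by
  rw [mem_sfWeight]
  rcases A with i | i
  · exact act_ofFun_coordFun (euler U) i
  · exact act_xi (euler U) i

theorem bas_mem_vfWeight (A : Idx) : bas U A ∈ vfWeight U (-idxWeight A) := by
  intro B
  rw [bas_apply]
  split_ifs with h
  · rw [h, neg_add_cancel]
    exact ofFun_one_mem_sfWeight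
  · exact Submodule.zero_mem _

theorem fmul_mem_vfWeight {k d : ℤ} {F : SFun U} {X : VF U} (hF : F ∈ sfWeight U d)
    (hX : X ∈ vfWeight U k) : F ⊡ X ∈ vfWeight U (d + k) := fun A => by
  rw [add_assoc]
  exact gmul_mem_sfWeight hF (hX A)

theorem e_mem_vfWeight : e U 0 ∈ vfWeight U (-1) ∧ e U 1 ∈ vfWeight U (-1) ∧
    e U 2 ∈ vfWeight U (-2) :=
  ⟨bas_mem_vfWeight (Sum.inl 0), bas_mem_vfWeight (Sum.inl 1), bas_mem_vfWeight (Sum.inl 2)⟩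

theorem vfWeight_cast {a k : ℤ} {X : VF U} (hX : X ∈ vfWeight U a) (h : a = k) :
    X ∈ vfWeight U k := h ▸ hX

theorem f_mem_vfWeight : f U 0 ∈ vfWeight U (-1) ∧ f U 1 ∈ vfWeight U (-1) ∧
    f U 2 ∈ vfWeight U (-2) := by
  refine ⟨?_, ?_, bas_mem_vfWeight (Sum.inr 2)⟩
  · change f1 U ∈ _
    rw [f1]
    refine Submodule.add_mem _ (Submodule.add_mem _ (bas_mem_vfWeight (Sum.inr 0)) ?_) ?_
    · exact vfWeight_cast (fmul_mem_vfWeight (coord_mem_sfWeight (Sum.inr 1))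
        (bas_mem_vfWeight (Sum.inl 2))) (by simp [idxWeight])
    · exact vfWeight_cast (fmul_mem_vfWeight (coord_mem_sfWeight (Sum.inl 0))
        (bas_mem_vfWeight (Sum.inr 2))) (by simp [idxWeight])
  · change f2 U ∈ _
    rw [f2]
    refine Submodule.add_mem _ (Submodule.add_mem _ (bas_mem_vfWeight (Sum.inr 1)) ?_) ?_
    · exact vfWeight_cast (fmul_mem_vfWeight (coord_mem_sfWeight (Sum.inr 0))
        (bas_mem_vfWeight (Sum.inl 2))) (by simp [idxWeight])
    · exact vfWeight_cast (fmul_mem_vfWeight (coord_mem_sfWeight (Sum.inl 1))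
        (bas_mem_vfWeight (Sum.inr 2))) (by simp [idxWeight])

theorem hCoeff_mem_sfWeight {k : ℤ} {X : VF U} (hX : X ∈ vfWeight U k) :
    hCoeff U X ∈ sfWeight U (k + 2) := by
  refine Submodule.sub_mem _ (Submodule.sub_mem _ (hX (Sum.inl 2)) ?_) ?_
  · have h := gmul_mem_sfWeight (hX (Sum.inr 0)) (coord_mem_sfWeight (Sum.inr 1))
    rwa [add_assoc] at h
  · have h := gmul_mem_sfWeight (hX (Sum.inr 1)) (coord_mem_sfWeight (Sum.inr 0))
    rwa [add_assoc] at h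

theorem gCoeff_mem_sfWeight {k : ℤ} {X : VF U} (hX : X ∈ vfWeight U k) :
    gCoeff U X ∈ sfWeight U (k + 2) := by
  refine Submodule.sub_mem _ (Submodule.sub_mem _ (hX (Sum.inr 2)) ?_) ?_
  · have h := gmul_mem_sfWeight (hX (Sum.inr 0)) (coord_mem_sfWeight (Sum.inl 0))
    rwa [add_assoc] at h
  · have h := gmul_mem_sfWeight (hX (Sum.inr 1)) (coord_mem_sfWeight (Sum.inl 1))
    rwa [add_assoc] at h

/-- In each term the weight lost by differentiating (1 for f₁, f₂ and 2 for ∂_{ξ₃}) is restored by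
the factors y₁, y₂. -/
theorem gShift_mem_sfWeight {d : ℤ} {H : SFun U} (hH : H ∈ sfWeight U d) (p : ZMod 2) :
    gShift U p H ∈ sfWeight U d := by
  refine Submodule.smul_mem _ _ (Submodule.sub_mem _ (Submodule.add_mem _ ?_ ?_) ?_)
  · have h := gmul_mem_sfWeight (act_mem_sfWeight f_mem_vfWeight.2.1 hH)
      (coord_mem_sfWeight (Sum.inl 0))
    rwa [show -1 + d + idxWeight (Sum.inl 0) = d by simp [idxWeight]] at h
  · have h := gmul_mem_sfWeight (act_mem_sfWeight f_mem_vfWeight.1 hH)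
      (coord_mem_sfWeight (Sum.inl 1))
    rwa [show -1 + d + idxWeight (Sum.inl 1) = d by simp [idxWeight]] at h
  · have h := gmul_mem_sfWeight (gmul_mem_sfWeight (coord_mem_sfWeight (U := U) (Sum.inl 0))
      (coord_mem_sfWeight (Sum.inl 1))) (pd_mem_sfWeight hH (Sum.inr 2))
    rwa [show idxWeight (Sum.inl 0) + idxWeight (Sum.inl 1) + (d - idxWeight (Sum.inr 2)) = d by
      simp [idxWeight]] at h

/-- The functions h and g are recovered as the e₃ coefficient and the shifted f₃ coefficient. Since
e₃, f₃ have weight -2 and the shift preserves weight, this accounts for k + 2. -/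
theorem symField_mem_vfWeight_iff {k : ℤ} {p : ZMod 2} {h g : SFun3 U} :
    symField U p h g ∈ vfWeight U k ↔
      lift U h ∈ sfWeight U (k + 2) ∧ lift U g ∈ sfWeight U (k + 2) := by
  constructor
  · intro hX
    have hh := hCoeff_mem_sfWeight hX
    have hg := gCoeff_mem_sfWeight hX
    rw [hCoeff_symField] at hh
    rw [gCoeff_symField, gTilde_eq] at hg
    refine ⟨hh, ?_⟩
    have := Submodule.add_mem _ hg (gShift_mem_sfWeight hh p)
    rwa [sub_add_cancel] at this
  · rintro ⟨hh, hg⟩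
    have hG : gTilde U p h g ∈ sfWeight U (k + 2) := by
      rw [gTilde_eq]
      exact Submodule.sub_mem _ hg (gShift_mem_sfWeight hh p)
    obtain ⟨e0, e1, e2⟩ := e_mem_vfWeight (U := U)
    obtain ⟨f0, f1, f2⟩ := f_mem_vfWeight (U := U)
    rw [symField_eq]
    refine Submodule.add_mem _ (Submodule.add_mem _ (Submodule.add_mem _ (Submodule.add_mem _
      (Submodule.smul_mem _ _ (Submodule.add_mem _ ?_ ?_)) ?_) ?_) ?_) ?_
    · exact vfWeight_cast (fmul_mem_vfWeight (act_mem_sfWeight f1 hh) f0) (by ring)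
    · exact vfWeight_cast (fmul_mem_vfWeight (act_mem_sfWeight f0 hh) f1) (by ring)
    · exact vfWeight_cast (fmul_mem_vfWeight hh e2) (by ring)
    · exact vfWeight_cast (fmul_mem_vfWeight hG f2) (by ring)
    · exact vfWeight_cast (fmul_mem_vfWeight (Submodule.smul_mem _ _ (act_mem_sfWeight f0 hG)) e0) (by ring)
    · exact vfWeight_cast (fmul_mem_vfWeight (Submodule.smul_mem _ _ (act_mem_sfWeight f1 hG)) e1) (by ring)

/-! ### The parametrization as a linear map -/

/-- The symmetry of parity `p` whose pair `(h, g)` consists of the components of `u` of parities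
`p` and `p + 1`. -/
def symLin (U : Opens (Fin 3 → ℂ)) (p : ZMod 2) : SFun3 U →ₗ[ℂ] VF U where
  toFun u := symField U p (sfComp p u) (sfComp (p + 1) u)
  map_add' u v := by
    have hG : ∀ h g h' g', gTilde U p (h + h') (g + g') = gTilde U p h g + gTilde U p h' g' := by
      intro h g h' g'
      simp only [gTilde_eq, gShift, lift_add, act_add_right, add_gmul, gmul_add, map_add]
      match_scalars <;> ring
    refine vf_ext ?_ ?_ ?_ ?_ ?_ ?_
    · simp only [map_add, hCoeff_symField, lift_add]
    · simp only [map_add, gCoeff_symField, hG]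
    all_goals
      simp only [Pi.add_apply, symField_apply, map_add, hG, act_add_right, lift_add, smul_add]
  map_smul' c u := by
    have hG : ∀ h g, gTilde U p (c • h) (c • g) = c • gTilde U p h g := by
      intro h g
      simp only [gTilde_eq, gShift, lift_smul, act_smul_right, smul_gmul, gmul_smul, map_smul]
      match_scalars <;> ring
    refine vf_ext ?_ ?_ ?_ ?_ ?_ ?_
    · simp only [map_smul, hCoeff_symField, lift_smul, RingHom.id_apply]
    · simp only [map_smul, gCoeff_symField, hG, RingHom.id_apply]
    all_goals
      simp only [Pi.smul_apply, symField_apply, map_smul, hG, act_smul_right, lift_smul,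
        RingHom.id_apply, smul_comm c]

theorem symLin_apply (p : ZMod 2) (u : SFun3 U) :
    symLin U p u = symField U p (sfComp p u) (sfComp (p + 1) u) := rfl

theorem sfComp_add_sfComp_succ {A : Type} [CommRing A] [Algebra ℂ A] (p : ZMod 2) (u : SF A) :
    sfComp p u + sfComp (p + 1) u = u := by
  rcases zmod_two_cases p with rfl | rfl
  · rw [zero_add, sfComp_zero_add_one]
  · rw [one_add_one_zmod, add_comm, sfComp_zero_add_one]

/-- The functions h and g have opposite parities, so together they are the two components of a
single superfunction. -/
theorem symLin_injective (p : ZMod 2) : Function.Injective (symLin U p) := by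
  intro u v huv
  obtain ⟨h1, h2⟩ := symField_injective huv
  rw [← sfComp_add_sfComp_succ p u, h1, h2, sfComp_add_sfComp_succ]

theorem symLin_mem_sym (p : ZMod 2) (u : SFun3 U) : symLin U p u ∈ sym U :=
  symField_mem_sym (sfComp_mem p u) (sfComp_mem (p + 1) u)

theorem symLin_mem_vfParity (p : ZMod 2) (u : SFun3 U) : symLin U p u ∈ vfParity U p :=
  symField_mem_vfParity (sfComp_mem p u) (sfComp_mem (p + 1) u)

theorem exists_symLin_eq (hfib : ∀ t : ℂ, IsPreconnected {y : Fin 3 → ℂ | y ∈ U ∧ y 2 = t})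
    {p : ZMod 2} {X : VF U} (hX : X ∈ vfParity U p) (hs : X ∈ sym U) :
    ∃ u, symLin U p u = X := by
  obtain ⟨h, hh, g, hg, rfl⟩ := exists_symField_eq hfib hX hs
  refine ⟨h + g, ?_⟩
  have hp : p + 1 ≠ p := by simp
  rw [symLin_apply, map_add, map_add, sfComp_of_mem hh, sfComp_of_mem hg,
    sfComp_of_mem_ne hh hp.symm, sfComp_of_mem_ne hg hp, add_zero, zero_add]

theorem lift_sfComp (p : ZMod 2) (u : SFun3 U) : lift U (sfComp p u) = sfComp p (lift U u) := by
  funext S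
  by_cases h : (S.card : ZMod 2) = p
  · simp [lift, sfComp, h]
  · simp only [lift, sfComp, LinearMap.coe_mk, AddHom.coe_mk, if_neg h]
    rfl

theorem symLin_mem_vfWeight_iff {k : ℤ} {p : ZMod 2} {u : SFun3 U} :
    symLin U p u ∈ vfWeight U k ↔ lift U u ∈ sfWeight U (k + 2) := by
  rw [symLin_apply, symField_mem_vfWeight_iff, lift_sfComp, lift_sfComp]
  constructor
  · rintro ⟨h, g⟩
    rw [← sfComp_add_sfComp_succ p (lift U u)]
    exact Submodule.add_mem _ h g
  · intro h
    exact ⟨sfComp_mem_sfWeight h _, sfComp_mem_sfWeight h _⟩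

end

/-! ### Monomial solutions of `t φ' = c φ` -/

open Filter Topology in
-- Dividing the equation by tⁿ off the origin leaves nψ + tψ' = cψ; then let t tend to 0.
theorem eq_natCast_of_mul_deriv_eq {φ ψ : ℂ → ℂ} {c : ℂ} {n : ℕ} (hψ : AnalyticAt ℂ ψ 0)
    (h0 : ψ 0 ≠ 0) (hφ : ∀ᶠ t in 𝓝 0, φ t = t ^ n * ψ t)
    (hode : ∀ᶠ t in 𝓝 0, t * deriv φ t = c * φ t) : c = n := by
  have hev : ∀ᶠ t in 𝓝[≠] (0 : ℂ), n * ψ t + t * deriv ψ t = c * ψ t := by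
    have hd : ∀ᶠ t in 𝓝 (0 : ℂ), AnalyticAt ℂ ψ t := hψ.eventually_analyticAt
    filter_upwards [hφ.eventually_nhds.filter_mono nhdsWithin_le_nhds,
      hode.filter_mono nhdsWithin_le_nhds, hd.filter_mono nhdsWithin_le_nhds,
      self_mem_nhdsWithin] with t h1 h2 h3 ht
    have ht0 : t ≠ 0 := ht
    have hder : deriv φ t = n * t ^ (n - 1) * ψ t + t ^ n * deriv ψ t := by
      rw [Filter.EventuallyEq.deriv_eq h1]
      exact ((hasDerivAt_pow n t).mul h3.differentiableAt.hasDerivAt).deriv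
    rw [hder, h1.self_of_nhds] at h2
    -- The case n = 0 is separate because n - 1 is truncated subtraction.
    have hp : t * (n * t ^ (n - 1)) = n * t ^ n := by
      rcases n with _ | n
      · simp
      · simp only [Nat.add_sub_cancel]; ring
    refine mul_left_cancel₀ (pow_ne_zero n ht0) ?_
    linear_combination h2 - ψ t * hp
  have hc1 : Tendsto (fun t => n * ψ t + t * deriv ψ t) (𝓝[≠] 0) (𝓝 (n * ψ 0 + 0 * deriv ψ 0)) :=
    ((continuousAt_const.mul hψ.continuousAt).add
      (continuousAt_id.mul hψ.deriv.continuousAt)).tendsto.mono_left nhdsWithin_le_nhds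
  have hc2 : Tendsto (fun t => c * ψ t) (𝓝[≠] 0) (𝓝 (c * ψ 0)) :=
    (continuousAt_const.mul hψ.continuousAt).tendsto.mono_left nhdsWithin_le_nhds
  have h := tendsto_nhds_unique (hc1.congr' hev) hc2
  refine mul_right_cancel₀ h0 ?_
  rw [← h]
  ring

open Filter Topology in
-- The vanishing order n of a nonzero solution must equal c. Subtracting the leading term leaves
-- another solution, of order greater than n, which must therefore vanish near 0.
theorem exists_eventually_eq_monomial {φ : ℂ → ℂ} {c : ℂ} (hφ : AnalyticAt ℂ φ 0)
    (hode : ∀ᶠ t in 𝓝 0, t * deriv φ t = c * φ t) :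
    ∃ (n : ℕ) (a : ℂ), (∀ᶠ t in 𝓝 0, φ t = a * t ^ n) ∧ (a = 0 ∨ c = n) := by
  by_cases hz : ∀ᶠ t in 𝓝 0, φ t = 0
  · exact ⟨0, 0, by simpa using hz, Or.inl rfl⟩
  obtain ⟨n, ψ, hψ, h0, hn⟩ := hφ.exists_eventuallyEq_pow_smul_nonzero_iff.2 hz
  simp only [sub_zero, smul_eq_mul] at hn
  have hc := eq_natCast_of_mul_deriv_eq hψ h0 hn hode
  refine ⟨n, ψ 0, ?_, Or.inr hc⟩
  set χ : ℂ → ℂ := fun t => φ t - ψ 0 * t ^ n with hχ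
  have hχa : AnalyticAt ℂ χ 0 := by
    refine hφ.sub ?_
    fun_prop
  have hχode : ∀ᶠ t in 𝓝 0, t * deriv χ t = c * χ t := by
    filter_upwards [hode, hφ.eventually_analyticAt] with t h1 h2
    have hd : deriv χ t = deriv φ t - ψ 0 * (n * t ^ (n - 1)) :=
      (h2.differentiableAt.hasDerivAt.sub ((hasDerivAt_pow n t).const_mul (ψ 0))).deriv
    have hp : t * (n * t ^ (n - 1)) = n * t ^ n := by
      rcases n with _ | n
      · simp
      · simp only [Nat.add_sub_cancel]; ring
    rw [hd, hχ]
    linear_combination h1 - ψ 0 * hp + hc * (ψ 0 * t ^ n)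
  by_cases hzχ : ∀ᶠ t in 𝓝 0, χ t = 0
  · filter_upwards [hzχ] with t ht
    exact sub_eq_zero.1 ht
  exfalso
  obtain ⟨m, ρ, hρ, hρ0, hm⟩ := hχa.exists_eventuallyEq_pow_smul_nonzero_iff.2 hzχ
  simp only [sub_zero, smul_eq_mul] at hm
  have hc' := eq_natCast_of_mul_deriv_eq hρ hρ0 hm hχode
  have hmn : m = n := by exact_mod_cast hc'.symm.trans hc
  subst hmn
  -- The remainder has the same order, so cancelling the power of t and letting t tend to 0 gives
  -- ρ(0) = 0, a contradiction.
  have hev : ∀ᶠ t in 𝓝[≠] (0 : ℂ), ψ t - ψ 0 = ρ t := by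
    filter_upwards [hn.filter_mono nhdsWithin_le_nhds, hm.filter_mono nhdsWithin_le_nhds,
      self_mem_nhdsWithin] with t h1 h2 ht
    have ht0 : t ≠ 0 := ht
    refine mul_left_cancel₀ (pow_ne_zero m ht0) ?_
    rw [← h2, hχ]
    linear_combination -h1
  have hc1 : Tendsto (fun t => ψ t - ψ 0) (𝓝[≠] 0) (𝓝 (ψ 0 - ψ 0)) :=
    (hψ.continuousAt.sub continuousAt_const).tendsto.mono_left nhdsWithin_le_nhds
  have hc2 : Tendsto ρ (𝓝[≠] 0) (𝓝 (ρ 0)) :=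
    hρ.continuousAt.tendsto.mono_left nhdsWithin_le_nhds
  have h := tendsto_nhds_unique (hc1.congr' hev) hc2
  exact hρ0 (by rw [← h, sub_self])

/-- The coordinate function on an open subset of `ℂ`. -/
def coordLine (W : Opens ℂ) : holo W :=
  ⟨fun t => t.1, fun _ ht =>
    (analyticAt_id (𝕜 := ℂ)).congr (zeroExt_restrict_eventuallyEq W (fun z => z) ht).symm⟩

theorem aeval_coordLine_apply {W : Opens ℂ} (P : Polynomial ℂ) (t : W) :
    (Polynomial.aeval (coordLine W) P).1 t = P.eval t.1 := by
  let ev : holo W →ₐ[ℂ] ℂ := (Pi.evalAlgHom ℂ (fun _ : W => ℂ) t).comp (holo W).val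
  have h := Polynomial.aeval_algHom_apply ev (coordLine W) P
  rw [Polynomial.aeval_def, ← Polynomial.eval_map_algebraMap] at h
  simp at h
  exact h.symm

theorem holo_ext_of_eventuallyEq {W : Opens ℂ} (hW : IsPreconnected (W : Set ℂ)) (h0 : (0 : ℂ) ∈ W)
    {φ ψ : holo W} (h : zeroExt W φ.1 =ᶠ[nhds 0] zeroExt W ψ.1) : φ = ψ := by
  ext t
  have := AnalyticOnNhd.eqOn_of_preconnected_of_eventuallyEq φ.2 ψ.2 hW h0 h t.2
  rwa [zeroExt_of_mem W _ t.2, zeroExt_of_mem W _ t.2] at this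

/-! ### The weight equation for functions of y₃ -/

section
variable {U : Opens (Fin 3 → ℂ)}

theorem pull_coordLine_pow (n : ℕ) : pull U (coordLine (proj3 U) ^ n) = coordFun U 2 ^ n := rfl

theorem pull_smul (c : ℂ) (φ : holo (proj3 U)) : pull U (c • φ) = c • pull U φ := rfl

theorem coordFun_mul_pderiv_pow (n : ℕ) :
    coordFun U 2 * pderiv U 2 (coordFun U 2 ^ n) = (n : ℂ) • coordFun U 2 ^ n := by
  induction n with
  | zero => simp [pderiv_one]
  | succ n ih =>
    rw [pow_succ, pderiv_mul, mul_add, ← mul_assoc, ih, pderiv_coordFun, if_pos rfl, mul_one,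
      Nat.cast_succ, add_smul, one_smul, smul_mul_assoc, mul_comm (coordFun U 2) (_ ^ n)]

theorem exists_monomial_of_ode (hW : IsPreconnected (proj3 U : Set ℂ)) (h0 : (0 : ℂ) ∈ proj3 U)
    {c : ℂ} {φ : holo (proj3 U)}
    (h : coordFun U 2 * pderiv U 2 (pull U φ) = c • pull U φ) :
    ∃ (n : ℕ) (a : ℂ), φ = a • coordLine (proj3 U) ^ n ∧ (a = 0 ∨ c = n) := by
  have hode : ∀ᶠ t in nhds (0 : ℂ), t * deriv (zeroExt (proj3 U) φ.1) t =
      c * zeroExt (proj3 U) φ.1 t := by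
    filter_upwards [(proj3 U).2.mem_nhds h0] with t ht
    obtain ⟨x, hx, rfl⟩ := ht
    have h1 : x 2 * (pderiv U 2 (pull U φ)).1 ⟨x, hx⟩ = c * (pull U φ).1 ⟨x, hx⟩ :=
      congrFun (congrArg Subtype.val h) ⟨x, hx⟩
    rw [pderiv_pull, Pi.single_eq_same, one_mul] at h1
    rw [zeroExt_of_mem (proj3 U) _ ⟨x, hx, rfl⟩]
    exact h1
  obtain ⟨n, a, hn, ha⟩ := exists_eventually_eq_monomial (φ.2 0 h0) hode
  refine ⟨n, a, holo_ext_of_eventuallyEq hW h0 ?_, ha⟩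
  filter_upwards [hn, (proj3 U).2.mem_nhds h0] with t ht ht'
  rw [ht, zeroExt_of_mem (proj3 U) _ ht']
  rfl

/-! ### Superfunctions of `y₃` of a given weight -/

/-- The weight of the monomial `ξ_S`. -/
def xiWeight (S : Finset (Fin 3)) : ℤ := ∑ i ∈ S, ![1, 1, 2] i

/-- The number operator of ξᵢ is diagonal in the monomials ξ_S, so the odd part of the Euler field
multiplies the S-component by its weight. -/
theorem xi_gmul_dxi {A : Type} [CommRing A] [Algebra ℂ A] (i : Fin 3) (F : SF A)
    (S : Finset (Fin 3)) : (xi A i ⋄ dxi i F) S = if i ∈ S then F S else 0 := by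
  revert S
  rw [forall_finset_fin_three]
  have h0 : ({0, 1} : Finset (Fin 3)) ≠ {0} ∧ ({0, 2} : Finset (Fin 3)) ≠ {0} ∧
    ({1, 2} : Finset (Fin 3)) ≠ {0} ∧ ({0, 1, 2} : Finset (Fin 3)) ≠ {0} := by decide
  have h1 : ({0, 1} : Finset (Fin 3)) ≠ {1} ∧ ({0, 2} : Finset (Fin 3)) ≠ {1} ∧
    ({1, 2} : Finset (Fin 3)) ≠ {1} ∧ ({0, 1, 2} : Finset (Fin 3)) ≠ {1} := by decide
  have h2 : ({0, 1} : Finset (Fin 3)) ≠ {2} ∧ ({0, 2} : Finset (Fin 3)) ≠ {2} ∧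
    ({1, 2} : Finset (Fin 3)) ≠ {2} ∧ ({0, 1, 2} : Finset (Fin 3)) ≠ {2} := by decide
  fin_cases i <;>
  simp [gmul_empty, gmul_0, gmul_1, gmul_2, gmul_01, gmul_02, gmul_12, gmul_012, dxi_0, dxi_1,
    dxi_2, xi, h0, h1, h2]

theorem act_euler_lift (u : SFun3 U) (S : Finset (Fin 3)) : act (euler U) (lift U u) S =
    (2 : ℂ) • (coordFun U 2 * pderiv U 2 (pull U (u S))) + (xiWeight S : ℂ) • pull U (u S) := by
  have hx : ∀ i, (xi (holo U) i ⋄ dxi i (lift U u)) S =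
      (if i ∈ S then (1 : ℂ) else 0) • pull U (u S) := by
    intro i
    rw [xi_gmul_dxi]
    split_ifs
    · rw [one_smul]; rfl
    · rw [zero_smul]
  rw [act_eq_sum, pd_lift_of_ne (by decide), pd_lift_of_ne (by decide)]
  simp only [gmul_zero, euler, smul_gmul, coord, Pi.add_apply, Pi.smul_apply, Pi.zero_apply, hx,
    ofFun_gmul, pd_inl_apply, idxWeight]
  have hw : (xiWeight S : ℂ) = (if (0 : Fin 3) ∈ S then (1 : ℂ) else 0) +
      (if (1 : Fin 3) ∈ S then (1 : ℂ) else 0) + 2 * (if (2 : Fin 3) ∈ S then (1 : ℂ) else 0) := by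
    have h : xiWeight S = ∑ i : Fin 3, if i ∈ S then ![1, 1, 2] i else 0 := by
      rw [Finset.sum_ite_mem, Finset.univ_inter, xiWeight]
    rw [h, Fin.sum_univ_three]
    push_cast
    simp
  rw [hw]
  by_cases h0 : (0 : Fin 3) ∈ S <;> by_cases h1 : (1 : Fin 3) ∈ S <;>
  by_cases h2 : (2 : Fin 3) ∈ S <;> simp [h0, h1, h2, lift] <;> module

/-- The weight condition decouples into one equation y₃φ' = cφ for each S; the 2 in the denominator
is the weight of y₃. -/
theorem lift_mem_sfWeight_iff {d : ℤ} {u : SFun3 U} : lift U u ∈ sfWeight U d ↔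
    ∀ S, coordFun U 2 * pderiv U 2 (pull U (u S)) =
      (((d - xiWeight S : ℤ) : ℂ) / 2) • pull U (u S) := by
  rw [mem_sfWeight, funext_iff]
  refine forall_congr' fun S => ?_
  rw [act_euler_lift, Pi.smul_apply]
  change _ = (d : ℂ) • pull U (u S) ↔ _
  rw [← eq_sub_iff_add_eq, ← sub_smul, ← Int.cast_sub]
  constructor
  · intro h
    rw [div_eq_inv_mul, mul_smul, ← h, smul_smul, inv_mul_cancel₀ two_ne_zero, one_smul]
  · intro h
    rw [h, smul_smul, mul_div_cancel₀ _ two_ne_zero]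

end

/-! ### Infinite dimension -/

section
variable {U : Opens (Fin 3 → ℂ)}

theorem aeval_coordLine_injective {W : Opens ℂ} {t : ℂ} (ht : t ∈ W) :
    Function.Injective (Polynomial.aeval (R := ℂ) (coordLine W)) := by
  rw [injective_iff_map_eq_zero]
  intro P hP
  refine Polynomial.eq_zero_of_infinite_isRoot P
    (Set.Infinite.mono ?_ (infinite_of_mem_nhds t (W.2.mem_nhds ht)))
  intro s hs
  have h := aeval_coordLine_apply P ⟨s, hs⟩
  rw [hP] at h
  exact h.symm

theorem not_finiteDimensional_sym (hU : (U : Set (Fin 3 → ℂ)).Nonempty) :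
    ¬ FiniteDimensional ℂ (sym U) := by
  intro hfin
  have hnoeth : IsNoetherian ℂ (sym U) := isNoetherian_of_isNoetherianRing_of_finite ℂ (sym U)
  obtain ⟨x, hx⟩ := hU
  have hxW : x 2 ∈ proj3 U := ⟨x, hx, rfl⟩
  -- Polynomials in y₃ alone embed into the even symmetries: such a u is even, so it serves as h,
  -- with g = 0.
  let L : Polynomial ℂ →ₗ[ℂ] sym U :=
    ((symLin U 0).codRestrict (sym U) (symLin_mem_sym 0)).comp
      ((LinearMap.single ℂ (fun _ : Finset (Fin 3) => holo (proj3 U)) ∅).comp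
        (Polynomial.aeval (R := ℂ) (coordLine (proj3 U))).toLinearMap)
  have hL : Function.Injective L := by
    intro P Q h
    have h' := symLin_injective 0 (congrArg Subtype.val h)
    exact aeval_coordLine_injective hxW (Pi.single_injective (M := fun _ => holo (proj3 U)) ∅ h')
  exact Polynomial.not_finite (R := ℂ) (Module.Finite.of_injective L hL)

/-! ### The dimensions of the graded components -/

/-- The superfunctions `u(y₃, ξ₁, ξ₂, ξ₃)` of weight `k + 2`. -/
def lineWeight (U : Opens (Fin 3 → ℂ)) (k : ℤ) : Submodule ℂ (SFun3 U) :=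
  (sfWeight U (k + 2)).comap
    ({ toFun := lift U, map_add' := lift_add, map_smul' := lift_smul } : SFun3 U →ₗ[ℂ] SFun U)

theorem mem_lineWeight {k : ℤ} {u : SFun3 U} :
    u ∈ lineWeight U k ↔ lift U u ∈ sfWeight U (k + 2) := Iff.rfl

theorem symWeight_inf_vfParity
    (hfib : ∀ t : ℂ, IsPreconnected {y : Fin 3 → ℂ | y ∈ U ∧ y 2 = t}) (k : ℤ) (p : ZMod 2) :
    symWeight U k ⊓ vfParity U p = (lineWeight U k).map (symLin U p) := by
  ext X
  constructor
  · rintro ⟨⟨hs, hw⟩, hp⟩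
    obtain ⟨u, rfl⟩ := exists_symLin_eq hfib hp hs
    exact ⟨u, symLin_mem_vfWeight_iff.1 hw, rfl⟩
  · rintro ⟨u, hu, rfl⟩
    exact ⟨⟨symLin_mem_sym p u, symLin_mem_vfWeight_iff.2 hu⟩, symLin_mem_vfParity p u⟩

/-- The condition that `y₃ⁿ ξ_S` has weight `k + 2` for some `n`. -/
def Admissible (k : ℤ) (S : Finset (Fin 3)) : Prop :=
  0 ≤ k + 2 - xiWeight S ∧ (k + 2 - xiWeight S) % 2 = 0

instance (k : ℤ) : DecidablePred (Admissible k) := fun S => by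
  unfold Admissible
  infer_instance

theorem card_admissible (k : ℤ) : Fintype.card {S // Admissible k S} = tableDim k := by
  rw [Fintype.card_subtype]
  -- For a range of k the condition is replaced by one not involving k, whose solutions can be
  -- counted by `decide`.
  have key : ∀ P : Finset (Fin 3) → Prop, [DecidablePred P] → (∀ S, Admissible k S ↔ P S) →
      (Finset.univ.filter P).card = tableDim k →
      (Finset.univ.filter (Admissible k)).card = tableDim k := by
    intro P _ h hc
    rw [← hc]
    congr 1
    ext S
    simp [h]
  have hw : ∀ S, 0 ≤ xiWeight S ∧ xiWeight S ≤ 4 := by decide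
  rcases lt_or_ge k (-2) with h | h
  · refine key (fun _ => False) (fun S => ?_) ?_
    · exact ⟨fun hS => by have := hS.1; have := hw S; omega, False.elim⟩
    · rw [tableDim, if_pos h]; decide
  rcases lt_or_ge k 1 with h1 | h1
  · obtain rfl | rfl | rfl : k = -2 ∨ k = -1 ∨ k = 0 := by omega
    all_goals decide
  -- For k ≥ 1 the bound k + 2 ≥ w(S) follows from the parity condition, since w(S) ≤ 4 and w(S) = 4
  -- is excluded when k = 1. Only parity remains, and each parity class contains four sets S.
  · have ht : tableDim k = 4 := by
      rw [tableDim, if_neg (by omega), if_neg (by omega), if_neg (by omega), if_neg (by omega)]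
    rcases Int.emod_two_eq_zero_or_one k with hk | hk
    · refine key (fun S => xiWeight S % 2 = 0) (fun S => ?_) ?_
      · have := hw S
        simp only [Admissible]
        omega
      · rw [ht]; decide
    · refine key (fun S => xiWeight S % 2 = 1) (fun S => ?_) ?_
      · have := hw S
        simp only [Admissible]
        omega
      · rw [ht]; decide

/-- The combination of the monomials `y₃ⁿ ξ_S` of weight `k + 2` with given coefficients. -/
def monomialMap (U : Opens (Fin 3 → ℂ)) (k : ℤ) : ({S // Admissible k S} → ℂ) →ₗ[ℂ] SFun3 U where
  toFun c S := if h : Admissible k S then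
    c ⟨S, h⟩ • coordLine (proj3 U) ^ ((k + 2 - xiWeight S) / 2).toNat else 0
  map_add' c c' := by
    funext S
    by_cases h : Admissible k S <;> simp [h, add_smul]
  map_smul' a c := by
    funext S
    by_cases h : Admissible k S <;> simp [h, mul_smul]

theorem monomialMap_injective (h0 : (0 : ℂ) ∈ proj3 U) (k : ℤ) :
    Function.Injective (monomialMap U k) := by
  intro c c' h
  funext ⟨S, hS⟩
  have h1 := congrFun h S
  simp only [monomialMap, LinearMap.coe_mk, AddHom.coe_mk, dif_pos hS] at h1
  set n := ((k + 2 - xiWeight S) / 2).toNat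
  have h2 : ∀ a : ℂ, a • coordLine (proj3 U) ^ n =
      Polynomial.aeval (coordLine (proj3 U)) (Polynomial.monomial n a) := fun a => by
    rw [Polynomial.aeval_monomial, Algebra.smul_def]
  rw [h2, h2] at h1
  exact Polynomial.monomial_injective n (aeval_coordLine_injective h0 h1)

theorem coordFun_mul_pderiv_pull_monomial (a : ℂ) (n : ℕ) :
    coordFun U 2 * pderiv U 2 (pull U (a • coordLine (proj3 U) ^ n)) =
      (n : ℂ) • pull U (a • coordLine (proj3 U) ^ n) := by
  rw [pull_smul, pull_coordLine_pow, map_smul, mul_smul_comm, coordFun_mul_pderiv_pow, smul_comm]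

theorem pull_zero : pull U 0 = 0 := rfl

/-- Each component solves y₃φ' = cφ with c half of k + 2 - w(S), so it is a multiple of a power of
y₃, and it can be nonzero only if c is a natural number. Having 0 among the values of y₃ is what
excludes other exponents. -/
theorem range_monomialMap (hW : IsPreconnected (proj3 U : Set ℂ)) (h0 : (0 : ℂ) ∈ proj3 U) (k : ℤ) :
    LinearMap.range (monomialMap U k) = lineWeight U k := by
  ext u
  rw [mem_lineWeight, lift_mem_sfWeight_iff]
  constructor
  · rintro ⟨c, rfl⟩ S
    by_cases hS : Admissible k S
    · simp only [monomialMap, LinearMap.coe_mk, AddHom.coe_mk, dif_pos hS]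
      rw [coordFun_mul_pderiv_pull_monomial]
      congr 1
      obtain ⟨h1, h2⟩ := hS
      have h3 : (((k + 2 - xiWeight S) / 2).toNat : ℤ) * 2 = k + 2 - xiWeight S := by omega
      rw [eq_div_iff two_ne_zero]
      exact_mod_cast h3
    · simp only [monomialMap, LinearMap.coe_mk, AddHom.coe_mk, dif_neg hS, pull_zero, map_zero,
        mul_zero, smul_zero]
  · intro h
    choose n a hn ha using fun S => exists_monomial_of_ode hW h0 (h S)
    refine ⟨fun S => a S.1, funext fun S => ?_⟩
    have hcast : a S ≠ 0 → k + 2 - xiWeight S = 2 * n S := by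
      intro haS
      have h1 := (ha S).resolve_left haS
      rw [div_eq_iff two_ne_zero] at h1
      have h2 : k + 2 - xiWeight S = n S * 2 := by exact_mod_cast h1
      rw [h2, mul_comm]
    simp only [monomialMap, LinearMap.coe_mk, AddHom.coe_mk]
    rw [hn S]
    by_cases haS : a S = 0
    · simp [haS]
    · have h2 := hcast haS
      have hadm : Admissible k S := ⟨by omega, by omega⟩
      rw [dif_pos hadm, h2, Int.mul_ediv_cancel_left _ two_ne_zero, Int.toNat_natCast]

theorem proj3_isPreconnected (hU : IsPreconnected (U : Set (Fin 3 → ℂ))) :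
    IsPreconnected (proj3 U : Set ℂ) :=
  hU.image _ (continuous_apply 2).continuousOn

theorem rank_symWeight_inf_vfParity
    (hfib : ∀ t : ℂ, IsPreconnected {y : Fin 3 → ℂ | y ∈ U ∧ y 2 = t})
    (h0 : (0 : Fin 3 → ℂ) ∈ U) (hU : IsPreconnected (U : Set (Fin 3 → ℂ))) (k : ℤ) (p : ZMod 2) :
    Module.rank ℂ ↥(symWeight U k ⊓ vfParity U p) = (tableDim k : Cardinal) := by
  have h0' : (0 : ℂ) ∈ proj3 U := ⟨0, h0, rfl⟩
  rw [symWeight_inf_vfParity hfib, rank_map_eq (symLin_injective p),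
    ← range_monomialMap (proj3_isPreconnected hU) h0',
    rank_range_of_injective _ (monomialMap_injective h0' k), rank_fun', card_admissible]

/-! ### Polynomial symmetries -/

/-- The polynomials in `y₁, y₂, y₃` as holomorphic functions on `U`. -/
def polyHolo (U : Opens (Fin 3 → ℂ)) : Subalgebra ℂ (holo U) :=
  (MvPolynomial.aeval (R := ℂ) (coordFun U)).range

theorem aeval_coordFun_apply (P : MvPolynomial (Fin 3) ℂ) (x : U) :
    (MvPolynomial.aeval (coordFun U) P).1 x = MvPolynomial.eval x.1 P := by
  induction P using MvPolynomial.induction_on with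
  | C a => simp
  | add P Q hP hQ =>
    rw [map_add, map_add, ← hP, ← hQ]
    rfl
  | mul_X P i hP =>
    rw [map_mul, map_mul, ← hP, MvPolynomial.aeval_X, MvPolynomial.eval_X]
    rfl

theorem mem_polyHolo {φ : holo U} : φ ∈ polyHolo U ↔
    ∃ P : MvPolynomial (Fin 3) ℂ, ∀ x : U, φ.1 x = MvPolynomial.eval x.1 P := by
  constructor
  · rintro ⟨P, rfl⟩
    exact ⟨P, aeval_coordFun_apply P⟩
  · rintro ⟨P, hP⟩
    exact ⟨P, Subtype.ext (funext fun x => (aeval_coordFun_apply P x).trans (hP x).symm)⟩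

theorem coordFun_mem_polyHolo (i : Fin 3) : coordFun U i ∈ polyHolo U :=
  ⟨MvPolynomial.X i, MvPolynomial.aeval_X _ _⟩

theorem pderiv_mem_polyHolo (i : Fin 3) {φ : holo U} (hφ : φ ∈ polyHolo U) :
    pderiv U i φ ∈ polyHolo U := by
  obtain ⟨P, rfl⟩ := hφ
  change pderiv U i (MvPolynomial.aeval (coordFun U) P) ∈ _
  induction P using MvPolynomial.induction_on with
  | C a =>
    rw [MvPolynomial.aeval_C, Algebra.algebraMap_eq_smul_one, map_smul, pderiv_one, smul_zero]
    exact Subalgebra.zero_mem _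
  | add P Q hP hQ =>
    rw [map_add, map_add]
    exact Subalgebra.add_mem _ hP hQ
  | mul_X P j hP =>
    rw [map_mul, pderiv_mul, MvPolynomial.aeval_X, pderiv_coordFun]
    refine Subalgebra.add_mem _ (Subalgebra.mul_mem _ hP (coordFun_mem_polyHolo j))
      (Subalgebra.mul_mem _ ⟨P, rfl⟩ ?_)
    split_ifs
    · exact Subalgebra.one_mem _
    · exact Subalgebra.zero_mem _

/-- Polynomial superfunctions. -/
def polySF (U : Opens (Fin 3 → ℂ)) : Submodule ℂ (SFun U) :=
  Submodule.pi Set.univ fun _ => Subalgebra.toSubmodule (polyHolo U)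

theorem mem_polySF {F : SFun U} : F ∈ polySF U ↔ ∀ S, F S ∈ polyHolo U := by
  simp [polySF, Submodule.mem_pi]

theorem mem_vfPoly {X : VF U} : X ∈ vfPoly U ↔ ∀ A, X A ∈ polySF U := by
  simp only [mem_polySF, mem_polyHolo]
  rfl

theorem gmul_mem_polySF {F G : SFun U} (hF : F ∈ polySF U) (hG : G ∈ polySF U) :
    F ⋄ G ∈ polySF U := by
  rw [mem_polySF] at *
  intro S
  exact Subalgebra.sum_mem _ fun T _ =>
    zsmul_mem (Subalgebra.mul_mem _ (hF T) (hG (S \ T))) _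

theorem pd_mem_polySF (A : Idx) {F : SFun U} (hF : F ∈ polySF U) : pd U A F ∈ polySF U := by
  rw [mem_polySF] at *
  intro S
  rcases A with i | i
  · exact pderiv_mem_polyHolo i (hF S)
  · by_cases h : i ∈ S
    · simp only [pd_inr, dxi, LinearMap.coe_mk, AddHom.coe_mk, if_pos h]
      exact Subalgebra.zero_mem _
    · simp only [pd_inr, dxi, LinearMap.coe_mk, AddHom.coe_mk, if_neg h]
      exact zsmul_mem (hF _) _

theorem sfComp_mem_polySF (p : ZMod 2) {F : SFun U} (hF : F ∈ polySF U) :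
    sfComp p F ∈ polySF U := by
  rw [mem_polySF] at *
  intro S
  by_cases h : (S.card : ZMod 2) = p
  · simpa [sfComp, h] using hF S
  · simp only [sfComp, LinearMap.coe_mk, AddHom.coe_mk, if_neg h]
    exact Subalgebra.zero_mem _

theorem act_mem_polySF {X : VF U} {F : SFun U} (hX : X ∈ vfPoly U) (hF : F ∈ polySF U) :
    act X F ∈ polySF U :=
  Submodule.sum_mem _ fun A _ => gmul_mem_polySF (mem_vfPoly.1 hX A) (pd_mem_polySF A hF)

theorem fmul_mem_vfPoly {F : SFun U} {X : VF U} (hF : F ∈ polySF U) (hX : X ∈ vfPoly U) :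
    F ⊡ X ∈ vfPoly U :=
  mem_vfPoly.2 fun A => gmul_mem_polySF hF (mem_vfPoly.1 hX A)

theorem single_mem_polySF (S : Finset (Fin 3)) {φ : holo U} (hφ : φ ∈ polyHolo U) :
    (Pi.single S φ : SFun U) ∈ polySF U := by
  rw [mem_polySF]
  intro T
  rw [Pi.single_apply]
  split_ifs
  · exact hφ
  · exact Subalgebra.zero_mem _

theorem coord_mem_polySF (A : Idx) : coord U A ∈ polySF U := by
  rcases A with i | i
  · exact single_mem_polySF ∅ (coordFun_mem_polyHolo i)
  · exact single_mem_polySF {i} (Subalgebra.one_mem _)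

theorem bas_mem_vfPoly (A : Idx) : bas U A ∈ vfPoly U := by
  rw [mem_vfPoly]
  intro B
  rw [bas_apply]
  split_ifs
  · exact single_mem_polySF ∅ (Subalgebra.one_mem _)
  · exact Submodule.zero_mem _

theorem f_mem_vfPoly (i : Fin 3) : f U i ∈ vfPoly U := by
  fin_cases i
  · exact Submodule.add_mem _ (Submodule.add_mem _ (bas_mem_vfPoly _)
      (fmul_mem_vfPoly (coord_mem_polySF _) (bas_mem_vfPoly _)))
      (fmul_mem_vfPoly (coord_mem_polySF _) (bas_mem_vfPoly _))
  · exact Submodule.add_mem _ (Submodule.add_mem _ (bas_mem_vfPoly _)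
      (fmul_mem_vfPoly (coord_mem_polySF _) (bas_mem_vfPoly _)))
      (fmul_mem_vfPoly (coord_mem_polySF _) (bas_mem_vfPoly _))
  · exact bas_mem_vfPoly _

theorem vfComp_mem_vfPoly (p : ZMod 2) {X : VF U} (hX : X ∈ vfPoly U) : vfComp p X ∈ vfPoly U :=
  mem_vfPoly.2 fun A => sfComp_mem_polySF _ (mem_vfPoly.1 hX A)

theorem gShift_mem_polySF (p : ZMod 2) {H : SFun U} (hH : H ∈ polySF U) :
    gShift U p H ∈ polySF U := by
  have hy : ∀ i, ofFun (coordFun U i) ∈ polySF U := fun i => coord_mem_polySF (Sum.inl i)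
  refine Submodule.smul_mem _ _ (Submodule.sub_mem _ (Submodule.add_mem _ ?_ ?_) ?_)
  · exact gmul_mem_polySF (act_mem_polySF (f_mem_vfPoly 1) hH) (hy 0)
  · exact gmul_mem_polySF (act_mem_polySF (f_mem_vfPoly 0) hH) (hy 1)
  · exact gmul_mem_polySF (gmul_mem_polySF (hy 0) (hy 1)) (pd_mem_polySF (Sum.inr 2) hH)

/-- As for weights: the coefficients determine h and g by polynomial operations, and `gShift`
preserves polynomials. -/
theorem symField_mem_vfPoly_iff {p : ZMod 2} {h g : SFun3 U} : symField U p h g ∈ vfPoly U ↔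
    lift U h ∈ polySF U ∧ lift U g ∈ polySF U := by
  constructor
  · intro hX
    rw [mem_vfPoly] at hX
    have hh : hCoeff U (symField U p h g) ∈ polySF U :=
      Submodule.sub_mem _ (Submodule.sub_mem _ (hX _)
        (gmul_mem_polySF (hX _) (coord_mem_polySF (Sum.inr 1))))
        (gmul_mem_polySF (hX _) (coord_mem_polySF (Sum.inr 0)))
    have hg : gCoeff U (symField U p h g) ∈ polySF U :=
      Submodule.sub_mem _ (Submodule.sub_mem _ (hX _)
        (gmul_mem_polySF (hX _) (coord_mem_polySF (Sum.inl 0))))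
        (gmul_mem_polySF (hX _) (coord_mem_polySF (Sum.inl 1)))
    rw [hCoeff_symField] at hh
    rw [gCoeff_symField, gTilde_eq] at hg
    refine ⟨hh, ?_⟩
    have := Submodule.add_mem _ hg (gShift_mem_polySF p hh)
    rwa [sub_add_cancel] at this
  · rintro ⟨hh, hg⟩
    have hG : gTilde U p h g ∈ polySF U := by
      rw [gTilde_eq]
      exact Submodule.sub_mem _ hg (gShift_mem_polySF p hh)
    have he : ∀ i, e U i ∈ vfPoly U := fun i => bas_mem_vfPoly _
    have hf : ∀ i, f U i ∈ vfPoly U := f_mem_vfPoly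
    rw [symField_eq]
    refine Submodule.add_mem _ (Submodule.add_mem _ (Submodule.add_mem _ (Submodule.add_mem _
      (Submodule.smul_mem _ _ (Submodule.add_mem _ ?_ ?_)) ?_) ?_) ?_) ?_
    · exact fmul_mem_vfPoly (act_mem_polySF (hf 1) hh) (hf 0)
    · exact fmul_mem_vfPoly (act_mem_polySF (hf 0) hh) (hf 1)
    · exact fmul_mem_vfPoly hh (he 2)
    · exact fmul_mem_vfPoly hG (hf 2)
    · exact fmul_mem_vfPoly (Submodule.smul_mem _ _ (act_mem_polySF (hf 0) hG)) (he 0)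
    · exact fmul_mem_vfPoly (Submodule.smul_mem _ _ (act_mem_polySF (hf 1) hG)) (he 1)

theorem symLin_mem_vfPoly_iff {p : ZMod 2} {u : SFun3 U} :
    symLin U p u ∈ vfPoly U ↔ lift U u ∈ polySF U := by
  rw [symLin_apply, symField_mem_vfPoly_iff, lift_sfComp, lift_sfComp]
  constructor
  · rintro ⟨h, g⟩
    rw [← sfComp_add_sfComp_succ p (lift U u)]
    exact Submodule.add_mem _ h g
  · intro h
    exact ⟨sfComp_mem_polySF _ h, sfComp_mem_polySF _ h⟩

/-- Since 0 ∈ U, the points (0, 0, t) lie in U for small t, where φ(t) is the given polynomial at y₁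
= y₂ = 0. The identity theorem extends the equality to all values of y₃. -/
theorem exists_aeval_eq_of_pull_mem_polyHolo (hW : IsPreconnected (proj3 U : Set ℂ))
    (h0 : (0 : Fin 3 → ℂ) ∈ U) {φ : holo (proj3 U)} (hφ : pull U φ ∈ polyHolo U) :
    ∃ Q : Polynomial ℂ, Polynomial.aeval (coordLine (proj3 U)) Q = φ := by
  obtain ⟨P, hP⟩ := mem_polyHolo.1 hφ
  have h0' : (0 : ℂ) ∈ proj3 U := ⟨0, h0, rfl⟩
  refine ⟨MvPolynomial.aeval ![0, 0, Polynomial.X] P, holo_ext_of_eventuallyEq hW h0' ?_⟩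
  have hc : ∀ᶠ t in nhds (0 : ℂ), (Pi.single 2 t : Fin 3 → ℂ) ∈ U := by
    have : Continuous fun t : ℂ => (Pi.single 2 t : Fin 3 → ℂ) :=
      continuous_pi fun i => by fin_cases i <;> simp <;> fun_prop
    exact this.continuousAt.preimage_mem_nhds (U.2.mem_nhds (by rw [Pi.single_zero]; exact h0))
  filter_upwards [hc] with t ht
  have htW : t ∈ proj3 U := ⟨_, ht, Pi.single_eq_same (M := fun _ : Fin 3 => ℂ) 2 t⟩
  rw [zeroExt_of_mem _ _ htW, zeroExt_of_mem _ _ htW, aeval_coordLine_apply]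
  have h1 := hP ⟨_, ht⟩
  rw [pull_apply] at h1
  have h2 : φ.1 ⟨t, htW⟩ = MvPolynomial.eval (Pi.single 2 t : Fin 3 → ℂ) P := by
    rw [← h1]
    congr 2
  rw [h2, ← Polynomial.coe_evalRingHom, MvPolynomial.aeval_def, MvPolynomial.hom_eval₂,
    MvPolynomial.eval, MvPolynomial.coe_eval₂Hom]
  congr 1
  · ext a; simp
  · funext i
    fin_cases i <;> simp

theorem symLin_single_mem_iSup_symWeight (p : ZMod 2) (S : Finset (Fin 3)) (Q : Polynomial ℂ) :
    symLin U p (Pi.single S (Polynomial.aeval (coordLine (proj3 U)) Q)) ∈ ⨆ k, symWeight U k := by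
  induction Q using Polynomial.induction_on' with
  | add P Q hP hQ =>
    rw [map_add, Pi.single_add, map_add]
    exact Submodule.add_mem _ hP hQ
  | monomial n a =>
    -- The monomial y₃ⁿ ξ_S has weight 2n + w(S), and this must equal k + 2.
    refine Submodule.mem_iSup_of_mem (2 * n + xiWeight S - 2)
      ⟨symLin_mem_sym _ _, symLin_mem_vfWeight_iff.2 (lift_mem_sfWeight_iff.2 fun T => ?_)⟩
    rw [Polynomial.aeval_monomial, ← Algebra.smul_def]
    by_cases hT : T = S
    · subst hT
      rw [Pi.single_eq_same, coordFun_mul_pderiv_pull_monomial]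
      congr 1
      push_cast
      ring
    · rw [Pi.single_eq_of_ne hT, pull_zero, map_zero, mul_zero, smul_zero]

/-- A symmetry of pure weight comes, in each parity, from a combination of monomials, hence is
polynomial. Conversely a polynomial symmetry comes from a u with polynomial components, which splits
into monomials of pure weight. -/
theorem iSup_symWeight (hfib : ∀ t : ℂ, IsPreconnected {y : Fin 3 → ℂ | y ∈ U ∧ y 2 = t})
    (h0 : (0 : Fin 3 → ℂ) ∈ U) (hU : IsPreconnected (U : Set (Fin 3 → ℂ))) :
    (⨆ k, symWeight U k) = sym U ⊓ vfPoly U := by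
  have hW := proj3_isPreconnected hU
  have h0' : (0 : ℂ) ∈ proj3 U := ⟨0, h0, rfl⟩
  apply le_antisymm
  · refine iSup_le fun k X hX => ⟨hX.1, ?_⟩
    rw [← vfComp_zero_add_one X]
    suffices h : ∀ p, vfComp p X ∈ vfPoly U from Submodule.add_mem _ (h 0) (h 1)
    intro p
    have hXp : vfComp p X ∈ symWeight U k ⊓ vfParity U p :=
      ⟨⟨vfComp_mem_sym hX.1 p, vfComp_mem_vfWeight hX.2 p⟩, vfComp_mem p X⟩
    rw [symWeight_inf_vfParity hfib, ← range_monomialMap hW h0'] at hXp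
    obtain ⟨_, ⟨c, rfl⟩, hc⟩ := hXp
    rw [← hc, symLin_mem_vfPoly_iff, mem_polySF]
    intro S
    by_cases hS : Admissible k S
    · simp only [lift, monomialMap, LinearMap.coe_mk, AddHom.coe_mk, dif_pos hS]
      rw [pull_smul, pull_coordLine_pow]
      exact Subalgebra.smul_mem _ (Subalgebra.pow_mem _ (coordFun_mem_polyHolo 2) _) _
    · simp only [lift, monomialMap, LinearMap.coe_mk, AddHom.coe_mk, dif_neg hS, pull_zero]
      exact Subalgebra.zero_mem _
  · rintro X ⟨hs, hP⟩
    rw [← vfComp_zero_add_one X]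
    suffices h : ∀ p, vfComp p X ∈ ⨆ k, symWeight U k from Submodule.add_mem _ (h 0) (h 1)
    intro p
    have hPp := vfComp_mem_vfPoly p hP
    obtain ⟨u, hu⟩ := exists_symLin_eq hfib (vfComp_mem p X) (vfComp_mem_sym hs p)
    rw [← hu, symLin_mem_vfPoly_iff, mem_polySF] at hPp
    choose Q hQ using fun S => exists_aeval_eq_of_pull_mem_polyHolo hW h0 (hPp S)
    rw [← hu, ← Finset.univ_sum_single u, map_sum]
    refine Submodule.sum_mem _ fun S _ => ?_
    rw [← hQ S]
    exact symLin_single_mem_iSup_symWeight p S (Q S)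

end

end SuperSym

end

theorem mainTheorem11 (U : Opens (Fin 3 → ℂ))
    (hfib : ∀ t : ℂ, IsPreconnected {y : Fin 3 → ℂ | y ∈ U ∧ y 2 = t}) :
    -- the structure relations of the frame
    (SuperSym.bracket (SuperSym.e U 0) (SuperSym.f U 0) = SuperSym.f U 2 ∧
      SuperSym.bracket (SuperSym.e U 1) (SuperSym.f U 1) = SuperSym.f U 2 ∧
      SuperSym.bracket (SuperSym.f U 0) (SuperSym.f U 1) = (2 : ℂ) • SuperSym.e U 2 ∧
      (∀ i j, SuperSym.bracket (SuperSym.e U i) (SuperSym.e U j) = 0) ∧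
      (∀ i j, ¬ (i = j ∧ i ≠ 2) → SuperSym.bracket (SuperSym.e U i) (SuperSym.f U j) = 0) ∧
      (∀ i j, ¬ (i = 0 ∧ j = 1) → ¬ (i = 1 ∧ j = 0) →
        SuperSym.bracket (SuperSym.f U i) (SuperSym.f U j) = 0)) ∧
    -- the symmetries form a Lie superalgebra
    (∀ X ∈ SuperSym.sym U, ∀ p, SuperSym.vfComp p X ∈ SuperSym.sym U) ∧
    (∀ X ∈ SuperSym.sym U, ∀ Y ∈ SuperSym.sym U, SuperSym.bracket X Y ∈ SuperSym.sym U) ∧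
    -- the parametrization by two arbitrary functions
    (∀ p : ZMod 2, Set.BijOn
      (fun hg : SuperSym.SFun3 U × SuperSym.SFun3 U => SuperSym.symField U p hg.1 hg.2)
      {hg | hg.1 ∈ SuperSym.sfParity (SuperSym.holo (SuperSym.proj3 U)) p ∧
        hg.2 ∈ SuperSym.sfParity (SuperSym.holo (SuperSym.proj3 U)) (p + 1)}
      {X | X ∈ SuperSym.sym U ∧ X ∈ SuperSym.vfParity U p}) ∧
    -- infinite dimension
    ((U : Set (Fin 3 → ℂ)).Nonempty → ¬ FiniteDimensional ℂ (SuperSym.sym U)) ∧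
    -- the grading and the dimensions of its components
    (∀ k l, ∀ X ∈ SuperSym.symWeight U k, ∀ Y ∈ SuperSym.symWeight U l,
      SuperSym.bracket X Y ∈ SuperSym.symWeight U (k + l)) ∧
    iSupIndep (SuperSym.symWeight U) ∧
    ((0 : Fin 3 → ℂ) ∈ U → IsPreconnected (U : Set (Fin 3 → ℂ)) →
      (⨆ k, SuperSym.symWeight U k) = SuperSym.sym U ⊓ SuperSym.vfPoly U ∧
      ∀ (k : ℤ) (p : ZMod 2),
        Module.rank ℂ ↥(SuperSym.symWeight U k ⊓ SuperSym.vfParity U p)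
          = (SuperSym.tableDim k : Cardinal)) := by
  refine ⟨SuperSym.structure_relations, fun X hX p => SuperSym.vfComp_mem_sym hX p,
    fun X hX Y hY => SuperSym.bracket_mem_sym hX hY, SuperSym.bijOn_symField hfib,
    SuperSym.not_finiteDimensional_sym, fun k l X hX Y hY => SuperSym.bracket_mem_symWeight hX hY,
    SuperSym.iSupIndep_symWeight, fun h0 hU => ⟨SuperSym.iSup_symWeight hfib h0 hU,
      SuperSym.rank_symWeight_inf_vfParity hfib h0 hU⟩⟩
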